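/- A Wheeler graph is a finite directed multigraph $G$ whose edges are labelled with characters from a totally ordered alphabet and whose $n$ vertices admit a total order $\pi$ (a Wheeler order) in which the vertices of in-degree $0$ precede those of positive in-degree and, for all edges $(u,v)$, $(u',v')$ labelled $a$, $a'$: if $a \prec a'$ then $v < v'$, and if $a = a'$ and $u < u'$ then $v \le v'$. A BWT of $G$ according to $\pi$ is a string $B$ that lists the labels of all edges of $G$ (with multiplicity) so that, whenever $u < u'$ in $\pi$, the labels of the out-edges of $u$ precede those of the out-edges of $u'$. Let $r$ be the number of runs (maximal non-empty unary substrings) in $B$. Let $D$ be a decomposition of $G$ into $\upsilon$ edge-disjoint directed paths (closed paths and single vertices are allowed) that together contain every edge and every vertex of $G$ and whose internal vertices each have in- and out-degree exactly $1$. Let the vertices be assigned distinct identifiers from $0$ to $n-1$ such that, whenever $(u,v)$ is an edge, neither $u$ nor $v$ is an endpoint of a path in $D$, and $u$ has identifier $i$, then $v$ has identifier $i+1$. Let $\phi$ be the function that maps the identifier of a vertex $u$ that is not first in $\pi$ to the identifier of the vertex that immediately precedes $u$ in $\pi$. Then, on a word RAM with words of $\Theta(\log n)$ bits, $G$ can be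 stored in $O(r+\upsilon)$ words of space such that $\phi(i)$ can be evaluated in $O(\log\log n)$ time for every identifier $i$ of a vertex other than the first one in $\pi$. That is, there are one fixed query program and absolute constants such that, for all such $G$, $\pi$, $B$, $D$ and identifiers, some memory content of $O(r+\upsilon)$ words lets the program, given $i$, output $\phi(i)$ in $O(1+\log\log n)$ steps, leaving the memory content unchanged. -/

import Mathlib

/-! ### Edge-labelled directed multigraphs, Wheeler orders, BWTs -/

/-- A directed multigraph with vertices `V`, edges `E` and edge labels in `A`. -/
structure LabelledMultigraph (V E A : Type*) where
  src : E → V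
  tgt : E → V
  lab : E → A

namespace LabelledMultigraph

variable {V E A : Type*}

/-- In-degree, counting parallel edges. -/
noncomputable def inDeg (G : LabelledMultigraph V E A) (v : V) : ℕ :=
  {e : E | G.tgt e = v}.ncard

/-- Out-degree, counting parallel edges. -/
noncomputable def outDeg (G : LabelledMultigraph V E A) (v : V) : ℕ :=
  {e : E | G.src e = v}.ncard

/-- `π` lists the vertices in a Wheeler order; `π v` is the rank of `v`. -/
def IsWheelerOrder [LinearOrder A] (G : LabelledMultigraph V E A) {n : ℕ}
    (π : V ≃ Fin n) : Prop :=
  (∀ u v, G.inDeg u = 0 → 0 < G.inDeg v → π u < π v) ∧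
  ∀ e e' : E,
    (G.lab e < G.lab e' → π (G.tgt e) < π (G.tgt e')) ∧
    (G.lab e = G.lab e' → π (G.src e) < π (G.src e') → π (G.tgt e) ≤ π (G.tgt e'))

/-- `B` is a Burrows-Wheeler transform of `G` according to `π`: the labels of all edges, each edge
listed once, in an order that respects the order `π` of the sources. -/
def IsBWT (G : LabelledMultigraph V E A) {n : ℕ} (π : V ≃ Fin n) (B : List A) : Prop :=
  ∃ L : List E, L.Nodup ∧ (∀ e, e ∈ L) ∧
    L.Pairwise (fun e e' => π (G.src e) ≤ π (G.src e')) ∧ B = L.map G.lab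

/-- A directed path, possibly closed or without edges: a first vertex and a list of consecutive
edges. -/
structure DiPath (G : LabelledMultigraph V E A) where
  start : V
  edges : List E
  head_src : ∀ e ∈ edges.head?, G.src e = start
  chain : edges.IsChain (fun e e' => G.tgt e = G.src e')

/-- The last vertex of a path. -/
def DiPath.finish {G : LabelledMultigraph V E A} (p : G.DiPath) : V :=
  (p.edges.getLast?.map G.tgt).getD p.start

/-- The vertices of a path, in order. -/
def DiPath.vertices {G : LabelledMultigraph V E A} (p : G.DiPath) : List V :=
  p.start :: p.edges.map G.tgt

/-- The internal vertices of a path: all but the first and the last one in the list. -/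
def DiPath.internal {G : LabelledMultigraph V E A} (p : G.DiPath) : List V :=
  p.vertices.tail.dropLast

/-- `D` decomposes `G` into edge-disjoint directed paths whose internal vertices have in- and
out-degree exactly 1: every edge lies on exactly one path (once), every vertex on some path. -/
def IsDecomposition (G : LabelledMultigraph V E A) (D : List G.DiPath) : Prop :=
  (D.flatMap DiPath.edges).Nodup ∧
  (∀ e : E, ∃ p ∈ D, e ∈ p.edges) ∧
  (∀ v : V, ∃ p ∈ D, v ∈ p.vertices) ∧
  ∀ p ∈ D, ∀ v ∈ p.internal, G.inDeg v = 1 ∧ G.outDeg v = 1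

/-- `v` is the first or last vertex of a path in `D`. -/
def IsEndpoint (G : LabelledMultigraph V E A) (D : List G.DiPath) (v : V) : Prop :=
  ∃ p ∈ D, v = p.start ∨ v = p.finish

/-- The identifiers `0, …, n - 1` grow by one along each edge neither of whose ends is an endpoint
of a path in `D`. -/
def IsIdentifierAssignment (G : LabelledMultigraph V E A) (D : List G.DiPath) {n : ℕ}
    (ident : V ≃ Fin n) : Prop :=
  ∀ e : E, ¬ G.IsEndpoint D (G.src e) → ¬ G.IsEndpoint D (G.tgt e) →
    (ident (G.tgt e) : ℕ) = (ident (G.src e) : ℕ) + 1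

end LabelledMultigraph

/-- The number of runs (maximal non-empty unary substrings) of a string. -/
def numRuns {A : Type*} [DecidableEq A] : List A → ℕ
  | [] => 0
  | [_] => 1
  | a :: b :: l => (if a = b then 0 else 1) + numRuns (b :: l)

/-- The generalized `φ`: it maps the identifier of a vertex to the identifier of the vertex that
immediately precedes it in the order `π`. (The first vertex of `π` has no predecessor; its
identifier is mapped to itself, a value that is never used.) -/
def wheelerPhi {V : Type*} {n : ℕ} (π ident : V ≃ Fin n) (i : Fin n) : Fin n :=
  ident (π.symm ⟨(π (ident.symm i) : ℕ) - 1, lt_of_le_of_lt (Nat.sub_le _ _) (π _).isLt⟩)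

/-! ### The word RAM -/

namespace WordRAM

/-- The binary word operations. -/
inductive BinOp
  | add | sub | mul | div | mod | and | or | xor | shl | shr

/-- Operations on `w`-bit words `a, b < 2 ^ w`; arithmetic is modulo `2 ^ w`, and division is
integer division, with `a / 0 = 0` and `a mod 0 = a`. -/
def BinOp.eval (w : ℕ) : BinOp → ℕ → ℕ → ℕ
  | .add, a, b => (a + b) % 2 ^ w
  | .sub, a, b => (a + (2 ^ w - b)) % 2 ^ w
  | .mul, a, b => (a * b) % 2 ^ w
  | .div, a, b => a / b
  | .mod, a, b => a % b
  | .and, a, b => a &&& b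
  | .or, a, b => a ||| b
  | .xor, a, b => a ^^^ b
  | .shl, a, b => (a * 2 ^ b) % 2 ^ w
  | .shr, a, b => a / 2 ^ b

/-- Instructions; `d`, `a`, `b` are register numbers and `t` is a position in the program. -/
inductive Instr
  /-- register `d` becomes the constant `c` (modulo `2 ^ w`) -/
  | const (d c : ℕ)
  /-- register `d` becomes register `a` -/
  | move (d a : ℕ)
  /-- register `d` becomes the result of an operation on registers `a` and `b` -/
  | op (o : BinOp) (d a b : ℕ)
  /-- register `d` becomes the memory cell whose address is in register `a` -/
  | load (d a : ℕ)
  /-- the memory cell whose address is in register `a` becomes register `b` -/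
  | store (a b : ℕ)
  /-- go to `t` if register `a` is smaller than register `b` -/
  | jlt (a b t : ℕ)
  /-- go to `t` if registers `a` and `b` are equal -/
  | jeq (a b t : ℕ)
  /-- stop -/
  | halt

/-- A program is a finite list of instructions, so it uses a constant number of registers. -/
abbrev Program := List Instr

/-- A configuration: program counter, registers, and a memory of fixed length. -/
structure Config where
  pc : ℕ
  reg : ℕ → ℕ
  mem : List ℕ

/-- One instruction, in unit time. There is no next configuration when the machine has stopped,
when the program counter has left the program, or when an address outside the memory is used. -/
def step (w : ℕ) (P : Program) (c : Config) : Option Config :=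
  match P[c.pc]? with
  | none => none
  | some .halt => none
  | some (.const d k) => some ⟨c.pc + 1, Function.update c.reg d (k % 2 ^ w), c.mem⟩
  | some (.move d a) => some ⟨c.pc + 1, Function.update c.reg d (c.reg a), c.mem⟩
  | some (.op o d a b) =>
      some ⟨c.pc + 1, Function.update c.reg d (o.eval w (c.reg a) (c.reg b)), c.mem⟩
  | some (.load d a) =>
      (c.mem[c.reg a]?).map fun x => ⟨c.pc + 1, Function.update c.reg d x, c.mem⟩
  | some (.store a b) =>
      if c.reg a < c.mem.length then
        some ⟨c.pc + 1, c.reg, c.mem.set (c.reg a) (c.reg b)⟩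
      else none
  | some (.jlt a b t) => some ⟨if c.reg a < c.reg b then t else c.pc + 1, c.reg, c.mem⟩
  | some (.jeq a b t) => some ⟨if c.reg a = c.reg b then t else c.pc + 1, c.reg, c.mem⟩

/-- `t` consecutive steps. -/
def steps (w : ℕ) (P : Program) : ℕ → Config → Option Config
  | 0, c => some c
  | t + 1, c => (step w P c).bind (steps w P t)

/-- The start of a query: the argument `x` in register 0, all other registers 0. -/
def query (mem : List ℕ) (x : ℕ) : Config :=
  ⟨0, fun k => if k = 0 then x else 0, mem⟩

/-- On the stored data `mem` and the argument `x`, program `P` on `w`-bit words reaches a `halt`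
instruction after at most `T` steps, with `y` in register 0 and the stored data intact. -/
def Answers (w : ℕ) (P : Program) (mem : List ℕ) (x T y : ℕ) : Prop :=
  ∃ t ≤ T, ∃ c : Config, steps w P t (query mem x) = some c ∧
    P[c.pc]? = some .halt ∧ c.reg 0 = y ∧ c.mem = mem

end WordRAM

namespace WordRAM

/-- The register file whose first registers are listed in `l`; the others are 0. -/
def regs (l : List ℕ) : ℕ → ℕ := fun k => l.getD k 0

theorem update_regs {l : List ℕ} {d : ℕ} (x : ℕ) (h : d < l.length) :
    Function.update (regs l) d x = regs (l.set d x) := by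
  funext k
  by_cases hk : k = d
  · subst hk
    simp [regs, h]
  · rw [Function.update_of_ne hk]
    simp [regs, Ne.symm hk]

/-- Started at position `pc` with registers `l`, program `P` halts after at most `T` steps with `y`
in register 0 and the memory intact. -/
def AnswersFrom (w : ℕ) (P : Program) (mem : List ℕ) (T pc : ℕ) (l : List ℕ) (y : ℕ) : Prop :=
  ∃ t ≤ T, ∃ c : Config, steps w P t ⟨pc, regs l, mem⟩ = some c ∧
    P[c.pc]? = some .halt ∧ c.reg 0 = y ∧ c.mem = mem

namespace AnswersFrom

variable {w : ℕ} {P : Program} {mem : List ℕ} {T pc y : ℕ} {l : List ℕ}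

theorem mono {T' : ℕ} (h : AnswersFrom w P mem T pc l y) (hT : T ≤ T') :
    AnswersFrom w P mem T' pc l y := by
  obtain ⟨t, ht, r⟩ := h
  exact ⟨t, ht.trans hT, r⟩

theorem of_step {pc' : ℕ} {l' : List ℕ}
    (h : step w P ⟨pc, regs l, mem⟩ = some ⟨pc', regs l', mem⟩)
    (next : AnswersFrom w P mem T pc' l' y) : AnswersFrom w P mem (T + 1) pc l y := by
  obtain ⟨t, ht, c, hc, r⟩ := next
  exact ⟨t + 1, Nat.succ_le_succ ht, c, by simp [steps, h, hc], r⟩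

theorem halt (hP : P[pc]? = some .halt) (h0 : regs l 0 = y) : AnswersFrom w P mem T pc l y :=
  ⟨0, Nat.zero_le _, _, rfl, hP, h0, rfl⟩

theorem const {d k : ℕ} (hP : P[pc]? = some (.const d k)) (hd : d < l.length) (hk : k < 2 ^ w)
    (next : AnswersFrom w P mem T (pc + 1) (l.set d k) y) :
    AnswersFrom w P mem (T + 1) pc l y := by
  refine of_step ?_ next
  simp [step, hP, update_regs _ hd, Nat.mod_eq_of_lt hk]

theorem move {d a : ℕ} (va : ℕ) (hP : P[pc]? = some (.move d a)) (hd : d < l.length)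
    (ha : regs l a = va) (next : AnswersFrom w P mem T (pc + 1) (l.set d va) y) :
    AnswersFrom w P mem (T + 1) pc l y := by
  refine of_step ?_ next
  simp [step, hP, update_regs _ hd, ha]

theorem op {o : BinOp} {d a b : ℕ} (va vb v : ℕ) (hP : P[pc]? = some (.op o d a b))
    (hd : d < l.length) (ha : regs l a = va) (hb : regs l b = vb) (hv : o.eval w va vb = v)
    (next : AnswersFrom w P mem T (pc + 1) (l.set d v) y) :
    AnswersFrom w P mem (T + 1) pc l y := by
  refine of_step ?_ next
  simp [step, hP, update_regs _ hd, ha, hb, hv]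

theorem add {d a b : ℕ} (va vb : ℕ) (hP : P[pc]? = some (.op .add d a b))
    (hd : d < l.length) (ha : regs l a = va) (hb : regs l b = vb) (hv : va + vb < 2 ^ w)
    (next : AnswersFrom w P mem T (pc + 1) (l.set d (va + vb)) y) :
    AnswersFrom w P mem (T + 1) pc l y :=
  op va vb _ hP hd ha hb (Nat.mod_eq_of_lt hv) next

theorem sub {d a b : ℕ} (va vb : ℕ) (hP : P[pc]? = some (.op .sub d a b))
    (hd : d < l.length) (ha : regs l a = va) (hb : regs l b = vb) (hle : vb ≤ va)
    (hv : va < 2 ^ w) (next : AnswersFrom w P mem T (pc + 1) (l.set d (va - vb)) y) :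
    AnswersFrom w P mem (T + 1) pc l y := by
  refine op va vb _ hP hd ha hb ?_ next
  simp only [BinOp.eval]
  rw [show va + (2 ^ w - vb) = va - vb + 2 ^ w by omega, Nat.add_mod_right,
    Nat.mod_eq_of_lt (by omega)]

theorem mul {d a b : ℕ} (va vb : ℕ) (hP : P[pc]? = some (.op .mul d a b))
    (hd : d < l.length) (ha : regs l a = va) (hb : regs l b = vb) (hv : va * vb < 2 ^ w)
    (next : AnswersFrom w P mem T (pc + 1) (l.set d (va * vb)) y) :
    AnswersFrom w P mem (T + 1) pc l y :=
  op va vb _ hP hd ha hb (Nat.mod_eq_of_lt hv) next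

theorem mod {d a b : ℕ} (va vb : ℕ) (hP : P[pc]? = some (.op .mod d a b))
    (hd : d < l.length) (ha : regs l a = va) (hb : regs l b = vb)
    (next : AnswersFrom w P mem T (pc + 1) (l.set d (va % vb)) y) :
    AnswersFrom w P mem (T + 1) pc l y :=
  op va vb _ hP hd ha hb rfl next

theorem shr {d a b : ℕ} (va vb : ℕ) (hP : P[pc]? = some (.op .shr d a b))
    (hd : d < l.length) (ha : regs l a = va) (hb : regs l b = vb)
    (next : AnswersFrom w P mem T (pc + 1) (l.set d (va / 2 ^ vb)) y) :
    AnswersFrom w P mem (T + 1) pc l y :=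
  op va vb _ hP hd ha hb rfl next

theorem load {d a : ℕ} (va v : ℕ) (hP : P[pc]? = some (.load d a)) (hd : d < l.length)
    (ha : regs l a = va) (hm : mem[va]? = some v)
    (next : AnswersFrom w P mem T (pc + 1) (l.set d v) y) :
    AnswersFrom w P mem (T + 1) pc l y := by
  refine of_step ?_ next
  simp [step, hP, update_regs _ hd, ha, hm]

theorem jump {a t : ℕ} (hP : P[pc]? = some (.jeq a a t))
    (next : AnswersFrom w P mem T t l y) : AnswersFrom w P mem (T + 1) pc l y := by
  refine of_step ?_ next
  simp [step, hP]

theorem jeq {a b t : ℕ} (va vb : ℕ) (hP : P[pc]? = some (.jeq a b t))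
    (ha : regs l a = va) (hb : regs l b = vb)
    (next : va = vb → AnswersFrom w P mem T t l y)
    (next' : va ≠ vb → AnswersFrom w P mem T (pc + 1) l y) :
    AnswersFrom w P mem (T + 1) pc l y := by
  by_cases h : va = vb
  · refine of_step ?_ (next h)
    simp [step, hP, ha, hb, h]
  · refine of_step ?_ (next' h)
    simp [step, hP, ha, hb, h]

theorem jlt {a b t : ℕ} (va vb : ℕ) (hP : P[pc]? = some (.jlt a b t))
    (ha : regs l a = va) (hb : regs l b = vb)
    (next : va < vb → AnswersFrom w P mem T t l y)
    (next' : vb ≤ va → AnswersFrom w P mem T (pc + 1) l y) :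
    AnswersFrom w P mem (T + 1) pc l y := by
  by_cases h : va < vb
  · refine of_step ?_ (next h)
    simp [step, hP, ha, hb, h]
  · refine of_step ?_ (next' (Nat.le_of_not_lt h))
    simp [step, hP, ha, hb, h]

end AnswersFrom

theorem answers_of_answersFrom {w : ℕ} {P : Program} {mem : List ℕ} {x T y : ℕ} (k : ℕ)
    (h : AnswersFrom w P mem T 0 (x :: List.replicate k 0) y) : Answers w P mem x T y := by
  have : query mem x = ⟨0, regs (x :: List.replicate k 0), mem⟩ := by
    simp only [query, Config.mk.injEq, true_and, and_true]
    funext j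
    cases j with
    | zero => simp [regs]
    | succ j => simp [regs, List.getD, List.getElem?_replicate]; split_ifs <;> rfl
  unfold Answers
  rw [this]
  exact h

end WordRAM

/-- For distinct residues `x`, `y`, few multipliers `a` make them collide modulo `s`. -/
theorem card_multipliers_collide_mul_le {p : ℕ} (hp : p.Prime) {s x y : ℕ} (hs : 0 < s)
    (hx : x < p) (hy : y < p) (hxy : x ≠ y) :
    ((Finset.Ico 1 p).filter fun a => (a * x % p) % s = (a * y % p) % s).card * s ≤
      2 * (p - 1) := by
  set M : ℤ := (((p - 1) / s : ℕ) : ℤ) with hM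
  have hpp : 0 < p := hp.pos
  have hcard : ((Finset.Ico 1 p).filter fun a => (a * x % p) % s = (a * y % p) % s).card ≤
      ((Finset.Icc (-M) M).erase 0).card := by
    apply Finset.card_le_card_of_injOn
      (fun a => (((a * x % p : ℕ) : ℤ) - ((a * y % p : ℕ) : ℤ)) / s)
    · intro a ha
      simp only [Finset.mem_coe, Finset.mem_filter, Finset.mem_Ico] at ha
      obtain ⟨⟨ha1, ha2⟩, hc⟩ := ha
      have hdvd : (s : ℤ) ∣ ((a * x % p : ℕ) : ℤ) - ((a * y % p : ℕ) : ℤ) :=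
        (Nat.modEq_iff_dvd.1 (show (a * y % p) ≡ (a * x % p) [MOD s] from hc.symm))
      obtain ⟨q, hq⟩ := hdvd
      have hs' : (s : ℤ) ≠ 0 := by exact_mod_cast hs.ne'
      have h1 : a * x % p < p := Nat.mod_lt _ hpp
      have h2 : a * y % p < p := Nat.mod_lt _ hpp
      have hne : a * x % p ≠ a * y % p := by
        intro h
        have : a * x ≡ a * y [MOD p] := h
        have hcop : Nat.gcd p a = 1 :=
          Nat.coprime_of_lt_prime (by omega) ha2 hp
        have := Nat.ModEq.cancel_left_of_coprime hcop this
        exact hxy (Nat.ModEq.eq_of_lt_of_lt this hx hy)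
      simp only [Finset.coe_erase, Finset.coe_Icc, Set.mem_sdiff, Set.mem_Icc,
        Set.mem_singleton_iff]
      rw [hq, Int.mul_ediv_cancel_left _ hs']
      have hq0 : q ≠ 0 := by
        rintro rfl
        apply hne
        have : ((a * x % p : ℕ) : ℤ) = ((a * y % p : ℕ) : ℤ) := by linarith
        exact_mod_cast this
      have key : ∀ z : ℤ, s * z ≤ ((p - 1 : ℕ) : ℤ) → z ≤ M := by
        intro z hz
        rw [hM, Int.natCast_div]
        exact (Int.le_ediv_iff_mul_le (by exact_mod_cast hs)).2 (by rwa [mul_comm])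
      refine ⟨⟨?_, key q (by omega)⟩, hq0⟩
      have := key (-q) (by rw [mul_neg]; omega)
      omega
    · intro a ha b hb hab
      simp only [Finset.mem_coe, Finset.mem_filter, Finset.mem_Ico] at ha hb
      obtain ⟨⟨ha1, ha2⟩, hc⟩ := ha
      obtain ⟨⟨hb1, hb2⟩, hd⟩ := hb
      have hda : (s : ℤ) ∣ ((a * x % p : ℕ) : ℤ) - ((a * y % p : ℕ) : ℤ) :=
        (Nat.modEq_iff_dvd.1 (show (a * y % p) ≡ (a * x % p) [MOD s] from hc.symm))
      have hdb : (s : ℤ) ∣ ((b * x % p : ℕ) : ℤ) - ((b * y % p : ℕ) : ℤ) :=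
        (Nat.modEq_iff_dvd.1 (show (b * y % p) ≡ (b * x % p) [MOD s] from hd.symm))
      have heq := (Int.ediv_left_inj hda hdb).1 hab
      have hz : ((a * x - a * y : ℤ) : ZMod p) = ((b * x - b * y : ℤ) : ZMod p) := by
        have h := congrArg (fun z : ℤ => (z : ZMod p)) heq
        simpa using h
      have := Fact.mk hp
      push_cast at hz
      have hsub : ((x : ZMod p) - y) ≠ 0 := by
        intro h
        have h := (ZMod.natCast_eq_natCast_iff' x y p).1 (sub_eq_zero.1 h)
        rw [Nat.mod_eq_of_lt hx, Nat.mod_eq_of_lt hy] at h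
        exact hxy h
      have hab' : (a : ZMod p) = b := by
        apply mul_right_cancel₀ hsub
        linear_combination hz
      have h := (ZMod.natCast_eq_natCast_iff' a b p).1 hab'
      rwa [Nat.mod_eq_of_lt ha2, Nat.mod_eq_of_lt hb2] at h
  have hc2 : ((Finset.Icc (-M) M).erase 0).card = 2 * ((p - 1) / s) := by
    generalize (p - 1) / s = k at hM
    rw [Finset.card_erase_of_mem (by simp only [Finset.mem_Icc]; omega), Int.card_Icc]
    omega
  calc _ ≤ 2 * ((p - 1) / s) * s := Nat.mul_le_mul_right _ (hc2 ▸ hcard)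
    _ = 2 * ((p - 1) / s * s) := by ring
    _ ≤ _ := Nat.mul_le_mul_left _ (Nat.div_mul_le_self _ _)

/-- The ordered pairs of distinct elements of `S` that collide under `x ↦ (a x mod p) mod s`. -/
def collidingPairs (S : Finset ℕ) (p s a : ℕ) : Finset (ℕ × ℕ) :=
  (S ×ˢ S).filter fun q => q.1 ≠ q.2 ∧ (a * q.1 % p) % s = (a * q.2 % p) % s

theorem exists_multiplier_card_collidingPairs_mul_le {p : ℕ} (hp : p.Prime) {s : ℕ} (hs : 0 < s)
    (S : Finset ℕ) (hS : ∀ x ∈ S, x < p) :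
    ∃ a < p, (collidingPairs S p s a).card * s ≤ 2 * S.card ^ 2 := by
  by_contra! hcon
  have h2 := hp.two_le
  have hsum : ∑ a ∈ Finset.Ico 1 p, (collidingPairs S p s a).card * s ≤
      ∑ q ∈ S ×ˢ S, 2 * (p - 1) := by
    rw [← Finset.sum_mul]
    have : ∑ a ∈ Finset.Ico 1 p, (collidingPairs S p s a).card =
        ∑ q ∈ S ×ˢ S, ((Finset.Ico 1 p).filter fun a =>
          q.1 ≠ q.2 ∧ (a * q.1 % p) % s = (a * q.2 % p) % s).card := by
      simp only [collidingPairs]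
      exact Finset.sum_card_bipartiteAbove_eq_sum_card_bipartiteBelow
        (fun a (q : ℕ × ℕ) => q.1 ≠ q.2 ∧ (a * q.1 % p) % s = (a * q.2 % p) % s)
    rw [this, Finset.sum_mul]
    apply Finset.sum_le_sum
    rintro ⟨x, y⟩ hq
    rw [Finset.mem_product] at hq
    by_cases hxy : x = y
    · simp [hxy]
    · simpa [hxy] using card_multipliers_collide_mul_le hp hs (hS x hq.1) (hS y hq.2) hxy
  have hlt : ∑ a ∈ Finset.Ico 1 p, 2 * S.card ^ 2 <
      ∑ a ∈ Finset.Ico 1 p, (collidingPairs S p s a).card * s := by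
    apply Finset.sum_lt_sum_of_nonempty
    · exact ⟨1, by simp; omega⟩
    · intro a ha
      exact hcon a (Finset.mem_Ico.1 ha).2
  simp only [Finset.sum_const, Nat.card_Ico, Finset.card_product, smul_eq_mul] at hsum hlt
  nlinarith

theorem exists_multiplier_injOn {p : ℕ} (hp : p.Prime) (S : Finset ℕ) (hS : ∀ x ∈ S, x < p) :
    ∃ a < p, Set.InjOn (fun x => (a * x % p) % (2 * S.card ^ 2 + 1)) S := by
  obtain ⟨a, ha, h⟩ := exists_multiplier_card_collidingPairs_mul_le hp
    (Nat.succ_pos (2 * S.card ^ 2)) S hS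
  refine ⟨a, ha, fun x hx y hy hxy => ?_⟩
  by_contra hne
  have : 0 < (collidingPairs S p (2 * S.card ^ 2 + 1) a).card :=
    Finset.card_pos.2 ⟨(x, y), by
      simp only [collidingPairs, Finset.mem_filter, Finset.mem_product]
      exact ⟨⟨hx, hy⟩, hne, hxy⟩⟩
  simp only [Nat.succ_eq_add_one] at h
  nlinarith

/-- Two-level perfect hashing in linear space: a slot for each number so that the elements of `S`
get distinct slots. -/
theorem exists_perfect_hash {p : ℕ} (hp : p.Prime) (S : Finset ℕ) (hS : ∀ x ∈ S, x < p)
    (hne : S.Nonempty) :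
    ∃ (a : ℕ) (mul size off : ℕ → ℕ) (tot : ℕ), a < p ∧ (∀ i, mul i < p) ∧ (∀ i, 0 < size i) ∧
      (∀ i < S.card, off i + size i ≤ tot) ∧ tot ≤ 7 * S.card ∧
      Set.InjOn (fun x => off (a * x % p % S.card) +
        mul (a * x % p % S.card) * x % p % size (a * x % p % S.card)) S := by
  have hN : 0 < S.card := hne.card_pos
  obtain ⟨a, ha, hcol⟩ := exists_multiplier_card_collidingPairs_mul_le hp hN S hS
  set h : ℕ → ℕ := fun x => a * x % p % S.card with hh
  let bucket : ℕ → Finset ℕ := fun i => S.filter fun x => h x = i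
  choose mul hmul hinj using fun i => exists_multiplier_injOn hp (bucket i)
    (fun x hx => hS x (Finset.mem_filter.1 hx).1)
  let size : ℕ → ℕ := fun i => 2 * (bucket i).card ^ 2 + 1
  let off : ℕ → ℕ := fun i => ∑ k ∈ Finset.range i, size k
  have hoff : ∀ i j, i < j → off i + size i ≤ off j := by
    intro i j hij
    have : off i + size i = ∑ k ∈ Finset.range (i + 1), size k :=
      (Finset.sum_range_succ _ _).symm
    rw [this]
    exact Finset.sum_le_sum_of_subset (Finset.range_subset_range.2 hij)
  refine ⟨a, mul, size, off, ∑ k ∈ Finset.range S.card, size k, ha, hmul,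
    fun i => Nat.succ_pos _, fun i hi => hoff i _ hi, ?_, ?_⟩
  · have hsq : ∑ k ∈ Finset.range S.card, (bucket k).card ^ 2 ≤ 3 * S.card := by
      have h1 : ∑ k ∈ Finset.range S.card, (bucket k).card ^ 2 =
          ((S ×ˢ S).filter fun q => h q.1 = h q.2).card := by
        rw [Finset.card_eq_sum_card_fiberwise (f := fun q : ℕ × ℕ => h q.1)
          (t := Finset.range S.card)]
        · apply Finset.sum_congr rfl
          intro k _
          rw [pow_two, ← Finset.card_product]
          congr 1
          ext ⟨x, y⟩
          simp only [bucket, Finset.mem_product, Finset.mem_filter]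
          constructor
          · rintro ⟨⟨h1, h2⟩, h3, h4⟩
            exact ⟨⟨⟨h1, h3⟩, h2.trans h4.symm⟩, h2⟩
          · rintro ⟨⟨⟨h1, h3⟩, h2⟩, h4⟩
            exact ⟨⟨h1, h4⟩, h3, h2 ▸ h4⟩
        · intro q _
          simp only [Finset.coe_range, Set.mem_Iio]
          exact Nat.mod_lt _ hN
      have h2 : ((S ×ˢ S).filter fun q => h q.1 = h q.2) ⊆
          S.image (fun x => (x, x)) ∪ collidingPairs S p S.card a := by
        rintro ⟨x, y⟩ hq
        simp only [Finset.mem_filter, Finset.mem_product] at hq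
        simp only [Finset.mem_union, Finset.mem_image, collidingPairs, Finset.mem_filter,
          Finset.mem_product]
        by_cases hxy : x = y
        · exact Or.inl ⟨x, hq.1.1, by rw [hxy]⟩
        · exact Or.inr ⟨hq.1, hxy, hq.2⟩
      have h3 : (collidingPairs S p S.card a).card ≤ 2 * S.card := by
        by_contra! hlt
        nlinarith
      calc _ = _ := h1
        _ ≤ _ := Finset.card_le_card h2
        _ ≤ _ := Finset.card_union_le _ _
        _ ≤ S.card + 2 * S.card := Nat.add_le_add Finset.card_image_le h3
        _ = _ := by ring
    calc _ = 2 * ∑ k ∈ Finset.range S.card, (bucket k).card ^ 2 + S.card := by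
          simp only [size, Finset.sum_add_distrib, ← Finset.mul_sum]
          simp
      _ ≤ _ := by omega
  · intro x hx y hy hxy
    have hxy : off (h x) + mul (h x) * x % p % size (h x) =
      off (h y) + mul (h y) * y % p % size (h y) := hxy
    have bx : mul (h x) * x % p % size (h x) < size (h x) := Nat.mod_lt _ (Nat.succ_pos _)
    have bY : mul (h y) * y % p % size (h y) < size (h y) := Nat.mod_lt _ (Nat.succ_pos _)
    rcases lt_trichotomy (h x) (h y) with hlt | heq | hlt
    · have := hoff _ _ hlt
      omega
    · rw [heq] at hxy
      exact hinj (h y) (Finset.mem_coe.2 (Finset.mem_filter.2 ⟨hx, heq⟩))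
        (Finset.mem_coe.2 (Finset.mem_filter.2 ⟨hy, rfl⟩)) (Nat.add_left_cancel hxy)
    · have := hoff _ _ hlt
      omega

namespace WordRAM

/-- Predecessor search: a binary search over the levels of a trie whose nodes are
kept in a hash table, followed by a binary search in a short piece of a sorted array. -/
def searchProgram : Program :=
  [.const 14 0, .load 5 14, .const 14 1, .load 6 14, .const 14 2, .load 7 14, .const 14 3,
   .load 8 14, .const 14 4, .load 9 14, .const 14 5, .load 10 14, .const 14 6, .load 11 14,
   .const 14 7, .load 12 14, .const 14 8, .load 13 14, .const 14 9, .load 19 14, .const 14 10,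
   .load 20 14, .const 14 11, .load 21 14, .const 14 12, .load 22 14, .const 14 13, .load 4 14,
   .const 1 1, .op .add 5 5 0, .move 3 20,
   .jeq 2 3 57, .op .add 14 2 3, .op .shr 14 14 1, .op .shr 15 5 14,
   .op .mul 16 7 15, .op .mod 16 16 6, .op .mod 16 16 8,
   .op .add 17 9 16, .load 17 17, .op .mul 17 17 15, .op .mod 17 17 6,
   .op .add 18 10 16, .load 18 18, .op .mod 17 17 18,
   .op .add 18 11 16, .load 18 18, .op .add 17 18 17,
   .op .add 18 12 17, .load 18 18, .jeq 18 15 53,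
   .op .add 2 14 1, .jeq 0 0 31,
   .move 3 14, .op .add 18 13 17, .load 4 18, .jeq 0 0 31,
   .move 2 4, .op .add 3 2 20, .jlt 3 19 61, .move 3 19,
   .op .add 16 2 1, .jeq 16 3 72, .op .add 14 2 3, .op .shr 14 14 1,
   .op .add 16 21 14, .load 16 16, .jlt 0 16 70, .move 2 14, .jeq 0 0 61,
   .move 3 14, .jeq 0 0 61,
   .op .add 16 21 2, .load 16 16, .op .sub 0 0 16, .op .add 17 22 2, .load 17 17,
   .op .add 0 17 0, .halt]

/-- The array of length `n` with entries `f` is stored in `mem` from address `b` on. -/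
def StoredAt (mem : List ℕ) (b n : ℕ) (f : ℕ → ℕ) : Prop :=
  ∀ i < n, mem[b + i]? = some (f i)

theorem StoredAt.add_lt {mem : List ℕ} {b n : ℕ} {f : ℕ → ℕ} (h : StoredAt mem b n f) {i : ℕ}
    (hi : i < n) : b + i < mem.length :=
  (List.getElem?_eq_some_iff.1 (h i hi)).1

/-- The parameters and the tables `searchProgram` works with: a sorted array `key` of length `m`
with associated values `val`, and a two-level hash table with `s` buckets and `tot` slots. -/
structure SearchTables where
  (L p a s bMul bSize bOff bKey bVal m bBrk bPhi tot : ℕ)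
  (mul size off slotKey slotVal key val : ℕ → ℕ)

namespace SearchTables

/-- The slot of `u` in the hash table. -/
def slot (S : SearchTables) (u : ℕ) : ℕ :=
  S.off (S.a * u % S.p % S.s) +
    S.mul (S.a * u % S.p % S.s) * u % S.p % S.size (S.a * u % S.p % S.s)

/-- The parameters, in the order in which they are stored. -/
def header (S : SearchTables) : List ℕ :=
  [2 ^ S.L, S.p, S.a, S.s, S.bMul, S.bSize, S.bOff, S.bKey, S.bVal, S.m, S.L, S.bBrk, S.bPhi,
    S.slotVal (S.slot 1)]

/-- The tables are stored in `mem`, and all numbers that occur fit into words of `w` bits. -/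
structure Stored (S : SearchTables) (w : ℕ) (mem : List ℕ) : Prop where
  header : S.header <+: mem
  mul : StoredAt mem S.bMul S.s S.mul
  size : StoredAt mem S.bSize S.s S.size
  off : StoredAt mem S.bOff S.s S.off
  slotKey : StoredAt mem S.bKey S.tot S.slotKey
  slotVal : StoredAt mem S.bVal S.tot S.slotVal
  key : StoredAt mem S.bBrk S.m S.key
  val : StoredAt mem S.bPhi S.m S.val
  s_pos : 0 < S.s
  slot_lt : ∀ u, S.slot u < S.tot
  length_lt : mem.length < 2 ^ w
  tot_le : S.tot ≤ 2 ^ w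
  a_lt : S.a < S.p
  mul_lt : ∀ i < S.s, S.mul i < S.p
  le_p : 2 ^ (S.L + 1) ≤ S.p
  p_lt : S.p * S.p ≤ 2 ^ w
  m_lt : 2 * S.m + S.L < 2 ^ w
  four_le : 4 ≤ w

/-- The registers of `searchProgram` once the parameters have been loaded. -/
def registers (S : SearchTables) (x lo hi v y t₁ t₂ t₃ t₄ t₅ : ℕ) : List ℕ :=
  [x, 1, lo, hi, v, y, S.p, S.a, S.s, S.bMul, S.bSize, S.bOff, S.bKey, S.bVal, t₁, t₂, t₃, t₄, t₅,
    S.m, S.L, S.bBrk, S.bPhi]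

variable {S : SearchTables} {w : ℕ} {mem : List ℕ}

theorem answersFrom_output (hS : S.Stored w mem) {x j : ℕ} (hj : j < S.m) (hx : S.key j ≤ x)
    (hxw : x < 2 ^ w) (hv : S.val j + (x - S.key j) < 2 ^ w)
    (hi v y t₁ t₂ t₃ t₄ t₅ : ℕ) :
    AnswersFrom w searchProgram mem 6 72 (S.registers x j hi v y t₁ t₂ t₃ t₄ t₅)
      (S.val j + (x - S.key j)) := by
  have hlen := hS.length_lt
  refine .add S.bBrk j rfl (by simp [registers]) rfl rfl ((hS.key.add_lt hj).trans hlen) ?_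
  refine .load (S.bBrk + j) (S.key j) rfl (by simp [registers]) rfl (hS.key j hj) ?_
  refine .sub x (S.key j) rfl (by simp [registers]) rfl rfl hx hxw ?_
  refine .add S.bPhi j rfl (by simp [registers]) rfl rfl ((hS.val.add_lt hj).trans hlen) ?_
  refine .load (S.bPhi + j) (S.val j) rfl (by simp [registers]) rfl (hS.val j hj) ?_
  refine .add (S.val j) (x - S.key j) rfl (by simp [registers]) rfl rfl hv ?_
  exact .halt rfl rfl

theorem answersFrom_arraySearch (hS : S.Stored w mem) {x j : ℕ} (hj : j < S.m)
    (hx : ∀ i < S.m, S.key i ≤ x ↔ i ≤ j)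
    (hxw : x < 2 ^ w) (hv : S.val j + (x - S.key j) < 2 ^ w) (k : ℕ) :
    ∀ lo hi v y t₁ t₂ t₃ t₄ t₅ : ℕ, lo ≤ j → j < hi → hi ≤ S.m → hi - lo ≤ 2 ^ k →
    AnswersFrom w searchProgram mem (9 * k + 8) 61 (S.registers x lo hi v y t₁ t₂ t₃ t₄ t₅)
      (S.val j + (x - S.key j)) := by
  have hm := hS.m_lt
  have hlen := hS.length_lt
  induction k with
  | zero =>
    intro lo hi v y t₁ t₂ t₃ t₄ t₅ hlo hhi hhm hk
    obtain rfl : lo = j := by omega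
    refine .add lo 1 rfl (by simp [registers]) rfl rfl (by omega) ?_
    refine .jeq (lo + 1) hi rfl rfl rfl (fun _ => ?_) (fun h => absurd h (by omega))
    exact answersFrom_output hS hj ((hx lo hj).2 le_rfl) hxw hv hi v y t₁ t₂ (lo + 1) t₄ t₅
  | succ k ih =>
    intro lo hi v y t₁ t₂ t₃ t₄ t₅ hlo hhi hhm hk
    rw [pow_succ] at hk
    refine .mono (T := 9 * k + 8 + 7 + 1 + 1) ?_ (by omega)
    refine .add lo 1 rfl (by simp [registers]) rfl rfl (by omega) ?_
    refine .jeq (lo + 1) hi rfl rfl rfl (fun h => ?_) (fun h => ?_)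
    · obtain rfl : lo = j := by omega
      exact .mono (answersFrom_output hS hj ((hx lo hj).2 le_rfl) hxw hv hi v y t₁ t₂ (lo + 1) t₄
        t₅) (by omega)
    have hmid : (lo + hi) / 2 < S.m := by omega
    refine .add lo hi rfl (by simp [registers]) rfl rfl (by omega) ?_
    refine .shr (lo + hi) 1 rfl (by simp [registers]) rfl rfl ?_
    rw [pow_one]
    refine .add S.bBrk ((lo + hi) / 2) rfl (by simp [registers]) rfl rfl
      ((hS.key.add_lt hmid).trans hlen) ?_
    refine .load (S.bBrk + (lo + hi) / 2) (S.key ((lo + hi) / 2)) rfl (by simp [registers]) rfl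
      (hS.key _ hmid) ?_
    refine .jlt x (S.key ((lo + hi) / 2)) rfl rfl rfl (fun h => ?_) (fun h => ?_)
    · have hjm : j < (lo + hi) / 2 := by
        by_contra! hle
        exact absurd ((hx _ hmid).2 hle) (by omega)
      refine .move ((lo + hi) / 2) rfl (by simp [registers]) rfl ?_
      refine .jump rfl ?_
      exact ih lo ((lo + hi) / 2) v y _ t₂ _ t₄ t₅ hlo hjm (by omega) (by omega)
    · have hjm : (lo + hi) / 2 ≤ j := (hx _ hmid).1 h
      refine .move ((lo + hi) / 2) rfl (by simp [registers]) rfl ?_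
      refine .jump rfl ?_
      exact ih ((lo + hi) / 2) hi v y _ t₂ _ t₄ t₅ hjm hhi hhm (by omega)

/-- `u` is found in the hash table. -/
def Found (S : SearchTables) (u : ℕ) : Prop := S.slotKey (S.slot u) = u

theorem answersFrom_levelSearch (hS : S.Stored w mem) {x y T z : ℕ}
    (hy : y < 2 ^ (S.L + 1))
    (next : ∀ h ≤ S.L, S.Found (y / 2 ^ h) → (h = 0 ∨ ¬ S.Found (y / 2 ^ (h - 1))) →
      ∀ t₁ t₂ t₃ t₄ t₅ : ℕ, AnswersFrom w searchProgram mem T 57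
        (S.registers x h h (S.slotVal (S.slot (y / 2 ^ h))) y t₁ t₂ t₃ t₄ t₅) z) (k : ℕ) :
    ∀ lo hi t₁ t₂ t₃ t₄ t₅ : ℕ, lo ≤ hi → hi ≤ S.L → hi - lo < 2 ^ k → S.Found (y / 2 ^ hi) →
      (lo = 0 ∨ ¬ S.Found (y / 2 ^ (lo - 1))) →
      AnswersFrom w searchProgram mem (24 * k + 1 + T) 31
        (S.registers x lo hi (S.slotVal (S.slot (y / 2 ^ hi))) y t₁ t₂ t₃ t₄ t₅) z := by
  have hlen := hS.length_lt
  have hm := hS.m_lt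
  have hLw : 2 * S.L < 2 ^ w := by
    have h1 : S.L < 2 ^ S.L := Nat.lt_two_pow_self
    have h2 := hS.le_p
    have h3 := hS.p_lt
    rw [pow_succ] at h2
    nlinarith
  induction k with
  | zero =>
    intro lo hi t₁ t₂ t₃ t₄ t₅ hle hL hk hf hlo
    obtain rfl : lo = hi := by omega
    refine .mono (T := T + 1) ?_ (by omega)
    refine .jeq lo lo rfl rfl rfl (fun _ => ?_) (fun h => absurd rfl h)
    exact next lo hL hf hlo t₁ t₂ t₃ t₄ t₅
  | succ k ih =>
    intro lo hi t₁ t₂ t₃ t₄ t₅ hle hL hk hf hlo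
    rw [pow_succ] at hk
    refine .mono (T := (24 * k + 1 + T) + 4 + 18 + 1 + 1) ?_ (by omega)
    refine .jeq lo hi rfl rfl rfl (fun h => ?_) (fun h => ?_)
    · subst h
      exact .mono (next lo hL hf hlo t₁ t₂ t₃ t₄ t₅) (by omega)
    refine .add lo hi rfl (by simp [registers]) rfl rfl (by omega) ?_
    refine .shr (lo + hi) 1 rfl (by simp [registers]) rfl rfl ?_
    rw [pow_one]
    obtain ⟨mid, hmid⟩ : ∃ mid, mid = (lo + hi) / 2 := ⟨_, rfl⟩
    rw [← hmid]
    obtain ⟨u, hu⟩ : ∃ u, u = y / 2 ^ mid := ⟨_, rfl⟩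
    refine .shr y mid rfl (by simp [registers]) rfl rfl ?_
    rw [← hu]
    have hup : u < S.p := by
      have := hS.le_p
      have : u ≤ y := hu ▸ Nat.div_le_self _ _
      omega
    have hap := hS.a_lt
    have hpp := hS.p_lt
    obtain ⟨i, hi'⟩ : ∃ i, i = S.a * u % S.p % S.s := ⟨_, rfl⟩
    have his : i < S.s := hi' ▸ Nat.mod_lt _ hS.s_pos
    have hslot : S.slot u = S.off i + S.mul i * u % S.p % S.size i := by rw [hi']; rfl
    have hslt := hS.slot_lt u
    refine .mul S.a u rfl (by simp [registers]) rfl rfl (by nlinarith) ?_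
    refine .mod (S.a * u) S.p rfl (by simp [registers]) rfl rfl ?_
    refine .mod (S.a * u % S.p) S.s rfl (by simp [registers]) rfl rfl ?_
    rw [← hi']
    change AnswersFrom w searchProgram mem _ 38
      (S.registers x lo hi (S.slotVal (S.slot (y / 2 ^ hi))) y mid u i t₄ t₅) z
    refine .add S.bMul i rfl (by simp [registers]) rfl rfl ((hS.mul.add_lt his).trans hlen) ?_
    refine .load (S.bMul + i) (S.mul i) rfl (by simp [registers]) rfl (hS.mul i his) ?_
    have hmi := hS.mul_lt i his
    refine .mul (S.mul i) u rfl (by simp [registers]) rfl rfl (by nlinarith) ?_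
    refine .mod (S.mul i * u) S.p rfl (by simp [registers]) rfl rfl ?_
    refine .add S.bSize i rfl (by simp [registers]) rfl rfl ((hS.size.add_lt his).trans hlen) ?_
    refine .load (S.bSize + i) (S.size i) rfl (by simp [registers]) rfl (hS.size i his) ?_
    change AnswersFrom w searchProgram mem _ 44
      (S.registers x lo hi (S.slotVal (S.slot (y / 2 ^ hi))) y mid u i (S.mul i * u % S.p)
        (S.size i)) z
    refine .mod (S.mul i * u % S.p) (S.size i) rfl (by simp [registers]) rfl rfl ?_
    refine .add S.bOff i rfl (by simp [registers]) rfl rfl ((hS.off.add_lt his).trans hlen) ?_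
    refine .load (S.bOff + i) (S.off i) rfl (by simp [registers]) rfl (hS.off i his) ?_
    refine .add (S.off i) (S.mul i * u % S.p % S.size i) rfl (by simp [registers]) rfl rfl
      (by have := hS.tot_le; omega) ?_
    rw [← hslot]
    change AnswersFrom w searchProgram mem _ 48
      (S.registers x lo hi (S.slotVal (S.slot (y / 2 ^ hi))) y mid u i (S.slot u) (S.off i)) z
    refine .add S.bKey (S.slot u) rfl (by simp [registers]) rfl rfl
      ((hS.slotKey.add_lt hslt).trans hlen) ?_
    refine .load (S.bKey + S.slot u) (S.slotKey (S.slot u)) rfl (by simp [registers]) rfl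
      (hS.slotKey _ hslt) ?_
    refine .jeq (S.slotKey (S.slot u)) u rfl rfl rfl (fun h => ?_) (fun h => ?_)
    · refine .move mid rfl (by simp [registers]) rfl ?_
      refine .add S.bVal (S.slot u) rfl (by simp [registers]) rfl rfl
        ((hS.slotVal.add_lt hslt).trans hlen) ?_
      refine .load (S.bVal + S.slot u) (S.slotVal (S.slot u)) rfl (by simp [registers]) rfl
        (hS.slotVal _ hslt) ?_
      refine .jump rfl ?_
      subst hu
      exact ih lo mid _ _ _ _ _ (by omega) (by omega) (by omega) h hlo
    · refine .mono (T := (24 * k + 1 + T) + 1 + 1) ?_ (by omega)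
      refine .add mid 1 rfl (by simp [registers]) rfl rfl (by omega) ?_
      refine .jump rfl ?_
      exact ih (mid + 1) hi _ _ _ _ _ (by omega) hL (by omega) hf
        (Or.inr (by rwa [Nat.add_sub_cancel, ← hu]))

end SearchTables

end WordRAM

namespace WordRAM

theorem AnswersFrom.parameter {w : ℕ} {P : Program} {mem : List ℕ} {T pc y : ℕ} {l : List ℕ}
    {k d : ℕ} (v : ℕ) (hP : P[pc]? = some (.const 14 k)) (hP' : P[pc + 1]? = some (.load d 14))
    (hl : 14 < l.length) (hd : d < l.length) (hk : k < 2 ^ w) (hm : mem[k]? = some v)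
    (next : AnswersFrom w P mem T (pc + 2) ((l.set 14 k).set d v) y) :
    AnswersFrom w P mem (T + 2) pc l y := by
  refine .const hP hl hk ?_
  refine .load k v hP' (by simpa using hd) (by simp [regs, hl]) hm ?_
  exact next

namespace SearchTables

variable {S : SearchTables} {w : ℕ} {mem : List ℕ}

theorem answers_searchProgram (hS : S.Stored w mem) {x j : ℕ} (hx : x < 2 ^ S.L) (hj : j < S.m)
    (hkey : ∀ i < S.m, S.key i ≤ x ↔ i ≤ j) (hv : S.val j + (x - S.key j) < 2 ^ w)
    (hroot : S.Found 1)
    (hlevel : ∀ h ≤ S.L, S.Found ((2 ^ S.L + x) / 2 ^ h) →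
      (h = 0 ∨ ¬ S.Found ((2 ^ S.L + x) / 2 ^ (h - 1))) →
      S.slotVal (S.slot ((2 ^ S.L + x) / 2 ^ h)) ≤ j ∧
        j < S.slotVal (S.slot ((2 ^ S.L + x) / 2 ^ h)) + S.L) :
    Answers w searchProgram mem x (33 * Nat.log 2 S.L + 77) (S.val j + (x - S.key j)) := by
  have hL : S.L < 2 ^ (Nat.log 2 S.L + 1) := Nat.lt_pow_succ_log_self (by norm_num) _
  have hm := hS.m_lt
  have hpow : 2 ^ (S.L + 1) ≤ 2 ^ w := by
    have h2 := hS.le_p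
    have h3 := hS.p_lt
    have : 0 < 2 ^ (S.L + 1) := by positivity
    nlinarith
  have hpow' : 2 ^ S.L + x < 2 ^ w := by rw [pow_succ] at hpow; omega
  have h16 : 16 ≤ 2 ^ w := by
    calc 16 = 2 ^ 4 := by norm_num
      _ ≤ _ := Nat.pow_le_pow_right (by norm_num) hS.four_le
  have hdiv : (2 ^ S.L + x) / 2 ^ S.L = 1 := by
    rw [Nat.add_div_left _ (by positivity), Nat.div_eq_of_lt hx]
  have hloop : ∀ t₁ t₂ t₃ t₄ t₅ : ℕ, AnswersFrom w searchProgram mem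
      (24 * (Nat.log 2 S.L + 1) + 1 + (9 * (Nat.log 2 S.L + 1) + 8 + 1 + 1 + 1 + 1)) 31
      (S.registers x 0 S.L (S.slotVal (S.slot 1)) (2 ^ S.L + x) t₁ t₂ t₃ t₄ t₅)
      (S.val j + (x - S.key j)) := by
    intro t₁ t₂ t₃ t₄ t₅
    have := answersFrom_levelSearch hS (x := x) (y := 2 ^ S.L + x)
      (T := 9 * (Nat.log 2 S.L + 1) + 8 + 1 + 1 + 1 + 1) (z := S.val j + (x - S.key j))
      (by rw [pow_succ]; omega) ?_ (Nat.log 2 S.L + 1) 0 S.L t₁ t₂ t₃ t₄ t₅ (Nat.zero_le _)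
      le_rfl hL (by rwa [hdiv]) (Or.inl rfl)
    · rwa [hdiv] at this
    · intro h hhL hf hlo t₁ t₂ t₃ t₄ t₅
      obtain ⟨hle, hlt⟩ := hlevel h hhL hf hlo
      generalize S.slotVal (S.slot ((2 ^ S.L + x) / 2 ^ h)) = v at hle hlt ⊢
      refine .move v rfl (by simp [registers]) rfl ?_
      refine .add v S.L rfl (by simp [registers]) rfl rfl (by omega) ?_
      refine .jlt (v + S.L) S.m rfl rfl rfl (fun hlm => ?_) (fun hlm => ?_)
      · exact .mono (answersFrom_arraySearch hS hj hkey (by omega) hv (Nat.log 2 S.L + 1) v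
          (v + S.L) v (2 ^ S.L + x)
          t₁ t₂ t₃ t₄ t₅ hle hlt hlm.le (by omega)) (by omega)
      · refine .move S.m rfl (by simp [registers]) rfl ?_
        exact answersFrom_arraySearch hS hj hkey (by omega) hv (Nat.log 2 S.L + 1) v S.m v
          (2 ^ S.L + x)
          t₁ t₂ t₃ t₄ t₅ hle hj le_rfl (by omega)
  have hpar : ∀ k v : ℕ, S.header[k]? = some v → mem[k]? = some v := by
    intro k v hk
    obtain ⟨rest, hrest⟩ := hS.header
    rw [← hrest, List.getElem?_append_left (List.getElem?_eq_some_iff.1 hk).1, hk]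
  refine answers_of_answersFrom 22 (.mono (T := (24 * (Nat.log 2 S.L + 1) + 1 +
    (9 * (Nat.log 2 S.L + 1) + 8 + 1 + 1 + 1 + 1)) + 3 + 28) ?_ (by omega))
  change AnswersFrom w searchProgram mem _ 0
    [x, 0, 0, 0, 0, 0, 0, 0, 0, 0, 0, 0, 0, 0, 0, 0, 0, 0, 0, 0, 0, 0, 0] _
  refine .parameter (2 ^ S.L) rfl rfl (by simp) (by simp) (by omega) (hpar _ _ rfl) ?_
  refine .parameter S.p rfl rfl (by simp) (by simp) (by omega) (hpar _ _ rfl) ?_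
  refine .parameter S.a rfl rfl (by simp) (by simp) (by omega) (hpar _ _ rfl) ?_
  refine .parameter S.s rfl rfl (by simp) (by simp) (by omega) (hpar _ _ rfl) ?_
  change AnswersFrom w searchProgram mem _ 8
    [x, 0, 0, 0, 0, 2 ^ S.L, S.p, S.a, S.s, 0, 0, 0, 0, 0, 3, 0, 0, 0, 0, 0, 0, 0, 0] _
  refine .parameter S.bMul rfl rfl (by simp) (by simp) (by omega) (hpar _ _ rfl) ?_
  refine .parameter S.bSize rfl rfl (by simp) (by simp) (by omega) (hpar _ _ rfl) ?_
  refine .parameter S.bOff rfl rfl (by simp) (by simp) (by omega) (hpar _ _ rfl) ?_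
  refine .parameter S.bKey rfl rfl (by simp) (by simp) (by omega) (hpar _ _ rfl) ?_
  refine .parameter S.bVal rfl rfl (by simp) (by simp) (by omega) (hpar _ _ rfl) ?_
  change AnswersFrom w searchProgram mem _ 18
    [x, 0, 0, 0, 0, 2 ^ S.L, S.p, S.a, S.s, S.bMul, S.bSize, S.bOff, S.bKey, S.bVal, 8, 0, 0, 0, 0,
      0, 0, 0, 0] _
  refine .parameter S.m rfl rfl (by simp) (by simp) (by omega) (hpar _ _ rfl) ?_
  refine .parameter S.L rfl rfl (by simp) (by simp) (by omega) (hpar _ _ rfl) ?_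
  refine .parameter S.bBrk rfl rfl (by simp) (by simp) (by omega) (hpar _ _ rfl) ?_
  refine .parameter S.bPhi rfl rfl (by simp) (by simp) (by omega) (hpar _ _ rfl) ?_
  refine .parameter (S.slotVal (S.slot 1)) rfl rfl (by simp) (by simp) (by omega) (hpar _ _ rfl) ?_
  change AnswersFrom w searchProgram mem _ 28
    [x, 0, 0, 0, S.slotVal (S.slot 1), 2 ^ S.L, S.p, S.a, S.s, S.bMul, S.bSize, S.bOff, S.bKey,
      S.bVal, 13, 0, 0, 0, 0, S.m, S.L, S.bBrk, S.bPhi] _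
  refine .const rfl (by simp) (by omega) ?_
  refine .add (2 ^ S.L) x rfl (by simp) rfl rfl hpow' ?_
  refine .move S.L rfl (by simp) rfl ?_
  exact hloop 13 0 0 0 0

end SearchTables

theorem storedAt_map_range_append (f : ℕ → ℕ) (n : ℕ) (post : List ℕ) :
    StoredAt ((List.range n).map f ++ post) 0 n f := by
  intro i hi
  rw [List.getElem?_append_left (by simpa using hi)]
  simp [hi]

theorem StoredAt.append_left {mem : List ℕ} {b n : ℕ} {f : ℕ → ℕ} (h : StoredAt mem b n f)
    {b' : ℕ} (pre : List ℕ) (hb : b' = pre.length + b) : StoredAt (pre ++ mem) b' n f := by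
  intro i hi
  rw [hb, List.getElem?_append_right (by omega), ← h i hi]
  congr 1
  omega

end WordRAM

/-- A linear-space dictionary on a set of positive numbers, each element `u` with a value `g u`. -/
theorem exists_dictionary {p : ℕ} (hp : p.Prime) (D : Finset ℕ) (hD : ∀ u ∈ D, u < p)
    (hne : D.Nonempty) (g : ℕ → ℕ) :
    ∃ (a : ℕ) (mul size off slotKey slotVal slot : ℕ → ℕ) (tot : ℕ), a < p ∧ (∀ i, mul i < p) ∧
      (∀ i < D.card, off i + size i ≤ tot) ∧ tot ≤ 7 * D.card ∧
      (∀ u, slot u = off (a * u % p % D.card) +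
        mul (a * u % p % D.card) * u % p % size (a * u % p % D.card)) ∧
      (∀ u, slot u < tot) ∧ (∀ j, slotKey j ∈ D ∨ slotKey j = 0) ∧
      (∀ j, ∃ u, slotVal j = g u) ∧
      ∀ u, 0 < u → (slotKey (slot u) = u ↔ u ∈ D) ∧ (u ∈ D → slotVal (slot u) = g u) := by
  obtain ⟨a, mul, size, off, tot, ha, hmul, hsize, hoff, htot, hinj⟩ :=
    exists_perfect_hash hp D hD hne
  obtain ⟨slot, hslot⟩ : ∃ slot : ℕ → ℕ, slot = fun x => off (a * x % p % D.card) +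
        mul (a * x % p % D.card) * x % p % size (a * x % p % D.card) := ⟨_, rfl⟩
  rw [← hslot] at hinj
  classical
  let slotKey : ℕ → ℕ := fun j => if h : ∃ u ∈ D, slot u = j then h.choose else 0
  have hin : ∀ u ∈ D, slotKey (slot u) = u := by
    intro u hu
    have h : ∃ v ∈ D, slot v = slot u := ⟨u, hu, rfl⟩
    simp only [slotKey, dif_pos h]
    exact hinj h.choose_spec.1 hu h.choose_spec.2
  have hmem : ∀ j, slotKey j ∈ D ∨ slotKey j = 0 := by
    intro j
    by_cases h : ∃ u ∈ D, slot u = j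
    · left
      simp only [slotKey, dif_pos h]
      exact h.choose_spec.1
    · right
      simp only [slotKey, dif_neg h]
  refine ⟨a, mul, size, off, slotKey, fun j => g (slotKey j), slot, tot, ha, hmul, hoff, htot,
    fun u => by rw [hslot], fun u => ?_, hmem, fun j => ⟨_, rfl⟩, fun u hu => ⟨⟨fun h => ?_, hin u⟩,
    fun h => by simp only [hin u h]⟩⟩
  · rw [hslot]
    refine lt_of_lt_of_le ?_ (hoff (a * u % p % D.card) (Nat.mod_lt _ hne.card_pos))
    exact Nat.add_lt_add_left (Nat.mod_lt _ (hsize _)) _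
  · rcases hmem (slot u) with h' | h'
    · rwa [h] at h'
    · omega

section Trie

variable (L m : ℕ) (key : ℕ → ℕ)

/-- The positions of the representatives, in units of `L`. -/
def repIndices : Finset ℕ := (Finset.range m).filter fun t => 1 ≤ t ∧ t * L < m

/-- The nodes of the binary trie of depth `L` on the representatives `key (t * L)`, numbered as in
a heap. -/
def trieNodes : Finset ℕ :=
  (repIndices L m ×ˢ Finset.range (L + 1)).image fun q => (2 ^ L + key (q.1 * L)) / 2 ^ q.2

/-- The root and all the children of trie nodes. -/
def trieChildren : Finset ℕ :=
  insert 1 ((trieNodes L m key).image (2 * ·) ∪ (trieNodes L m key).image (2 * · + 1))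

/-- `L` times the number of representatives that do not lie to the right of `u`. -/
def trieRank (u : ℕ) : ℕ :=
  L * ((repIndices L m).filter fun t => (2 ^ L + key (t * L)) / 2 ^ (L - Nat.log 2 u) ≤ u).card

variable {L m key}

theorem mem_trieChildren {c : ℕ} : c ∈ trieChildren L m key ↔ c = 1 ∨ c / 2 ∈ trieNodes L m key := by
  simp only [trieChildren, Finset.mem_insert, Finset.mem_union, Finset.mem_image]
  constructor
  · rintro (h | ⟨a, ha, rfl⟩ | ⟨a, ha, rfl⟩)
    · exact Or.inl h
    · right
      rwa [show 2 * a / 2 = a by omega]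
    · right
      rwa [show (2 * a + 1) / 2 = a by omega]
  · rintro (h | h)
    · exact Or.inl h
    · right
      rcases Nat.even_or_odd' c with ⟨k, rfl | rfl⟩
      · exact Or.inl ⟨_, h, by omega⟩
      · exact Or.inr ⟨_, h, by omega⟩

theorem card_filter_repIndices (hL : 0 < L) {j : ℕ} (hj : j < m) :
    ((repIndices L m).filter fun t => t * L ≤ j).card = j / L := by
  have : ((repIndices L m).filter fun t => t * L ≤ j) = Finset.Icc 1 (j / L) := by
    ext t
    simp only [repIndices, Finset.mem_filter, Finset.mem_range, Finset.mem_Icc,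
      Nat.le_div_iff_mul_le hL]
    constructor
    · rintro ⟨⟨-, h1, -⟩, h2⟩
      exact ⟨h1, h2⟩
    · rintro ⟨h1, h2⟩
      have : t ≤ t * L := Nat.le_mul_of_pos_right _ hL
      exact ⟨⟨by omega, h1, by omega⟩, h2⟩
  rw [this, Nat.card_Icc, Nat.add_sub_cancel]

theorem card_repIndices_mul_le (hL : 0 < L) (hm : 0 < m) : (repIndices L m).card * L ≤ m := by
  have h := card_filter_repIndices hL (show m - 1 < m by omega)
  rw [Finset.filter_true_of_mem] at h
  · rw [h]
    exact (Nat.div_mul_le_self _ _).trans (Nat.sub_le _ _)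
  · intro t ht
    have := (Finset.mem_filter.1 ht).2.2
    omega

theorem card_trieChildren_le (hL : 0 < L) (hm : 0 < m) :
    (trieChildren L m key).card ≤ 4 * m + 1 := by
  have h1 : (trieNodes L m key).card ≤ 2 * m := by
    refine Finset.card_image_le.trans ?_
    rw [Finset.card_product, Finset.card_range]
    have := card_repIndices_mul_le hL hm
    nlinarith
  have h2 := Finset.card_insert_le 1
    ((trieNodes L m key).image (2 * ·) ∪ (trieNodes L m key).image (2 * · + 1))
  have h3 := Finset.card_union_le
    ((trieNodes L m key).image (2 * ·)) ((trieNodes L m key).image (2 * · + 1))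
  have h4 : ((trieNodes L m key).image (2 * ·)).card ≤ _ := Finset.card_image_le
  have h5 : ((trieNodes L m key).image (2 * · + 1)).card ≤ _ := Finset.card_image_le
  unfold trieChildren
  omega

theorem lt_of_mem_trieChildren (hkey : ∀ i < m, key i < 2 ^ L) {c : ℕ}
    (hc : c ∈ trieChildren L m key) : c < 2 ^ (L + 2) := by
  have hpos : 0 < 2 ^ L := by positivity
  rw [pow_add]
  rcases mem_trieChildren.1 hc with rfl | h
  · omega
  · obtain ⟨⟨t, h⟩, ht, hte⟩ := Finset.mem_image.1 h
    have ht := (Finset.mem_filter.1 (Finset.mem_product.1 ht).1).2.2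
    have := hkey (t * L) ht
    have := Nat.div_le_self (2 ^ L + key (t * L)) (2 ^ h)
    simp only at hte
    omega

theorem trieRank_le (hL : 0 < L) (hm : 0 < m) (u : ℕ) : trieRank L m key u ≤ m := by
  refine le_trans ?_ (card_repIndices_mul_le hL hm)
  rw [mul_comm]
  exact Nat.mul_le_mul_left _ (Finset.card_filter_le _ _)

/-- The deepest ancestor of `x` among the children of trie nodes has the rank of `x`. -/
theorem trieRank_of_deepest (hL : 0 < L) {x j h : ℕ} (hx : x < 2 ^ L) (hj : j < m)
    (hkey : ∀ i < m, key i ≤ x ↔ i ≤ j) (hh : h ≤ L)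
    (hdeep : h = 0 ∨ (2 ^ L + x) / 2 ^ (h - 1) ∉ trieChildren L m key) :
    trieRank L m key ((2 ^ L + x) / 2 ^ h) = L * (j / L) := by
  have hlog : L - Nat.log 2 ((2 ^ L + x) / 2 ^ h) = h := by
    have : Nat.log 2 ((2 ^ L + x) / 2 ^ h) = L - h := by
      have hp : 0 < 2 ^ h := by positivity
      rw [Nat.log_eq_iff (Or.inr ⟨by norm_num,
        (Nat.div_pos ((Nat.pow_le_pow_right (by norm_num) hh).trans (by omega)) hp).ne'⟩)]
      have e1 : 2 ^ (L - h) * 2 ^ h = 2 ^ L := by rw [← pow_add, Nat.sub_add_cancel hh]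
      constructor
      · rw [Nat.le_div_iff_mul_le hp]
        omega
      · rw [Nat.div_lt_iff_lt_mul hp, pow_succ]
        nlinarith
    omega
  unfold trieRank
  rw [hlog, ← card_filter_repIndices hL hj]
  congr 2
  apply Finset.filter_congr
  intro t ht
  have htm := (Finset.mem_filter.1 ht).2.2
  rw [← hkey _ htm]
  constructor
  · intro hle
    by_contra! hlt
    rcases hdeep with rfl | hdeep
    · simp only [pow_zero, Nat.div_one] at hle
      omega
    · by_cases h0 : h = 0
      · subst h0
        simp only [pow_zero, Nat.div_one] at hle
        omega
      · apply hdeep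
        rw [mem_trieChildren, Nat.div_div_eq_div_mul, ← pow_succ, Nat.sub_add_cancel (by omega)]
        right
        rw [le_antisymm (Nat.div_le_div_right (by omega)) hle]
        exact Finset.mem_image.2 ⟨(t, h), Finset.mem_product.2 ⟨ht, Finset.mem_range.2 (by omega)⟩,
          rfl⟩
  · intro hle
    exact Nat.div_le_div_right (by omega)

end Trie

namespace WordRAM

/-- A static predecessor structure of linear size over `m` keys of `L` bits, the first of which
is 0. -/
theorem exists_predecessor_structure {L m : ℕ} (hL : 0 < L) (hm : 0 < m) (hmL : m ≤ 2 ^ L)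
    (key val : ℕ → ℕ) (hkey : ∀ i < m, key i < 2 ^ L) (hval : ∀ i < m, val i < 2 ^ L) :
    ∃ mem : List ℕ, mem.length ≤ 101 * m ∧ (∀ x ∈ mem, x < 2 ^ (10 * L)) ∧
      ∀ x < 2 ^ L, ∀ j < m, (∀ i < m, key i ≤ x ↔ i ≤ j) →
        Answers (10 * L) searchProgram mem x (33 * Nat.log 2 L + 77) (val j + (x - key j)) := by
  obtain ⟨p, hp, hlp, hpl⟩ := Nat.exists_prime_lt_and_le_two_mul (2 ^ (L + 2)) (by positivity)
  obtain ⟨D, hDef⟩ : ∃ D, D = trieChildren L m key := ⟨_, rfl⟩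
  have hDlt : ∀ u ∈ D, u < 2 ^ (L + 2) := fun u hu =>
    lt_of_mem_trieChildren hkey (hDef ▸ hu)
  have hone : 1 ∈ D := hDef ▸ mem_trieChildren.2 (Or.inl rfl)
  have hcard : D.card ≤ 4 * m + 1 := hDef ▸ card_trieChildren_le hL hm
  obtain ⟨a, mul, size, off, slotKey, slotVal, slot, tot, ha, hmul, hoff, htot, hslot, hslt,
    hsk, hsv, hfound⟩ := exists_dictionary hp D (fun u hu => (hDlt u hu).trans hlp) ⟨1, hone⟩
      (trieRank L m key)
  let S : SearchTables :=
    { L := L, p := p, a := a, s := D.card, bMul := 14, bSize := 14 + D.card,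
      bOff := 14 + D.card + D.card, bKey := 14 + D.card + D.card + D.card,
      bVal := 14 + D.card + D.card + D.card + tot, m := m,
      bBrk := 14 + D.card + D.card + D.card + tot + tot,
      bPhi := 14 + D.card + D.card + D.card + tot + tot + m, tot := tot,
      mul := mul, size := size, off := off, slotKey := slotKey, slotVal := slotVal, key := key,
      val := val }
  have hSslot : ∀ u, S.slot u = slot u := fun u => (hslot u).symm
  let mem : List ℕ := S.header ++ ((List.range D.card).map mul ++ ((List.range D.card).map size ++
    ((List.range D.card).map off ++ ((List.range tot).map slotKey ++
      ((List.range tot).map slotVal ++ ((List.range m).map key ++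
        ((List.range m).map val ++ [])))))))
  have hlen : mem.length = 14 + 3 * D.card + 2 * tot + 2 * m := by
    simp only [mem, SearchTables.header, List.length_append, List.length_cons, List.length_map,
      List.length_range, List.length_nil]
    ring
  have hlen' : mem.length ≤ 101 * m := by omega
  have hpos : 0 < 2 ^ L := by positivity
  have hL2 : L < 2 ^ L := Nat.lt_two_pow_self
  have hW : 2 ^ L * 128 ≤ 2 ^ (10 * L) := by
    rw [show (128 : ℕ) = 2 ^ 7 by norm_num, ← pow_add]
    exact Nat.pow_le_pow_right (by norm_num) (by omega)
  have hpp : p * p ≤ 2 ^ (10 * L) := by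
    calc p * p ≤ (2 * 2 ^ (L + 2)) * (2 * 2 ^ (L + 2)) := Nat.mul_le_mul hpl hpl
      _ = 2 ^ (2 * L + 6) := by ring
      _ ≤ _ := Nat.pow_le_pow_right (by norm_num) (by omega)
  rw [pow_add] at hpl hlp
  have hsvm : ∀ j, slotVal j ≤ m := by
    intro j
    obtain ⟨u, hu⟩ := hsv j
    rw [hu]
    exact trieRank_le hL hm u
  have hskl : ∀ j, slotKey j < 2 ^ L * 4 := by
    intro j
    rcases hsk j with h | h
    · have := hDlt _ h
      rwa [pow_add] at this
    · omega
  have hstored : S.Stored (10 * L) mem :=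
    { header := ⟨_, rfl⟩
      mul := (storedAt_map_range_append _ _ _).append_left _ rfl
      size := ((storedAt_map_range_append _ _ _).append_left _ rfl).append_left _
        (by simp [S, SearchTables.header])
      off := (((storedAt_map_range_append _ _ _).append_left _ rfl).append_left _ rfl).append_left _
        (by simp [S, SearchTables.header]; ring)
      slotKey := ((((storedAt_map_range_append _ _ _).append_left _ rfl).append_left _
        rfl).append_left _ rfl).append_left _ (by simp [S, SearchTables.header]; ring)
      slotVal := (((((storedAt_map_range_append _ _ _).append_left _ rfl).append_left _
        rfl).append_left _ rfl).append_left _ rfl).append_left _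
        (by simp [S, SearchTables.header]; ring)
      key := ((((((storedAt_map_range_append _ _ _).append_left _ rfl).append_left _
        rfl).append_left _ rfl).append_left _ rfl).append_left _ rfl).append_left _
        (by simp [S, SearchTables.header]; ring)
      val := (((((((storedAt_map_range_append _ _ _).append_left _ rfl).append_left _
        rfl).append_left _ rfl).append_left _ rfl).append_left _ rfl).append_left _ rfl).append_left
        _ (by simp [S, SearchTables.header]; ring)
      s_pos := Finset.card_pos.2 ⟨1, hone⟩
      slot_lt := fun u => by rw [hSslot]; exact hslt u
      length_lt := by omega
      tot_le := by simp only [S]; omega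
      a_lt := ha
      mul_lt := fun i _ => hmul i
      le_p := by simp only [S]; rw [pow_succ]; omega
      p_lt := hpp
      m_lt := by simp only [S]; omega
      four_le := by omega }
  refine ⟨mem, hlen', ?_, ?_⟩
  · intro x hx
    simp only [mem, S, SearchTables.header, List.mem_append, List.mem_cons, List.mem_map,
      List.mem_range, List.not_mem_nil, or_false] at hx
    have := hsvm (S.slot 1)
    rcases hx with h | ⟨i, hi, rfl⟩ | ⟨i, hi, rfl⟩ | ⟨i, hi, rfl⟩ | ⟨i, hi, rfl⟩ | ⟨i, hi, rfl⟩ |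
      ⟨i, hi, rfl⟩ | ⟨i, hi, rfl⟩
    · rcases h with h | h | h | h | h | h | h | h | h | h | h | h | h | h <;> rw [h] <;>
        first | omega | exact lt_of_le_of_lt this (by omega)
    · have := hmul i
      omega
    · have := hoff i hi
      omega
    · have := hoff i hi
      omega
    · have := hskl i
      omega
    · have := hsvm i
      omega
    · have := hkey i hi
      omega
    · have := hval i hi
      omega
  · intro x hx j hj hxj
    have hkj := hkey j hj
    have hvj := hval j hj
    have hF : ∀ u, 0 < u → (S.Found u ↔ u ∈ D) := by
      intro u hu
      unfold SearchTables.Found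
      rw [hSslot]
      exact (hfound u hu).1
    have hupos : ∀ h ≤ L, 0 < (2 ^ L + x) / 2 ^ h := fun h hh =>
      Nat.div_pos ((Nat.pow_le_pow_right (by norm_num) hh).trans (by omega)) (by positivity)
    refine SearchTables.answers_searchProgram hstored hx hj hxj ?_ ((hF 1 one_pos).2 hone) ?_
    · simp only [S]
      omega
    · intro h hh hf hdeep
      have hu := hupos h hh
      have hval : slotVal (slot ((2 ^ L + x) / 2 ^ h)) = L * (j / L) := by
        rw [(hfound _ hu).2 ((hF _ hu).1 hf)]
        refine trieRank_of_deepest hL hx hj hxj hh (hdeep.imp_right fun hnot hmem => hnot ?_)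
        exact (hF _ (hupos _ ((Nat.sub_le _ _).trans hh))).2 (hDef ▸ hmem)
      rw [hSslot]
      change slotVal (slot ((2 ^ L + x) / 2 ^ h)) ≤ j ∧ j < slotVal (slot ((2 ^ L + x) / 2 ^ h)) + L
      rw [hval]
      have h1 := Nat.div_add_mod j L
      have h2 := Nat.mod_lt j hL
      omega

end WordRAM

/-- The elements of a list that begin a new run of `f`, apart from the first element. -/
def runStarts {E A : Type*} [DecidableEq A] (f : E → A) : List E → List E
  | [] => []
  | [_] => []
  | a :: b :: l => if f a = f b then runStarts f (b :: l) else b :: runStarts f (b :: l)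

theorem length_runStarts_le {E A : Type*} [DecidableEq A] (f : E → A) (l : List E) :
    (runStarts f l).length ≤ numRuns (l.map f) := by
  fun_induction runStarts f l with
  | case1 => simp
  | case2 => simp
  | case3 a b l h ih => simpa [numRuns, h] using ih
  | case4 a b l h ih =>
    simp only [List.map_cons, numRuns, h, if_false, List.length_cons] at ih ⊢
    omega

theorem mem_runStarts {E A : Type*} [DecidableEq A] {f : E → A} {a b : E} (hab : f a ≠ f b)
    (l₁ l₂ : List E) : b ∈ runStarts f (l₁ ++ a :: b :: l₂) := by
  induction l₁ with
  | nil => simp [runStarts, hab]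
  | cons c l₁ ih =>
    obtain ⟨d, l, hl⟩ : ∃ d l, l₁ ++ a :: b :: l₂ = d :: l := by
      cases l₁ <;> exact ⟨_, _, rfl⟩
    rw [List.cons_append, hl, runStarts]
    rw [hl] at ih
    split_ifs
    · exact ih
    · exact List.mem_cons_of_mem _ ih

theorem card_filter_exists_le {α β : Type*} [Fintype α] (t : Finset β) (r : α → β → Prop)
    [DecidablePred fun a => ∃ b ∈ t, r a b]
    (h : ∀ b a a', r a b → r a' b → a = a') :
    (Finset.univ.filter fun a => ∃ b ∈ t, r a b).card ≤ t.card := by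
  apply Finset.card_le_card_of_forall_subsingleton r
  · intro a ha
    exact (Finset.mem_filter.1 ha).2
  · intro b _ a ha a' ha'
    exact h b a a' ha.2 ha'.2

theorem card_filter_or_le {α : Type*} [Fintype α] {p q : α → Prop} [DecidablePred p]
    [DecidablePred q] [DecidablePred fun a => p a ∨ q a] {b c : ℕ}
    (hp : (Finset.univ.filter p).card ≤ b) (hq : (Finset.univ.filter q).card ≤ c) :
    (Finset.univ.filter fun a => p a ∨ q a).card ≤ b + c := by
  classical
  refine le_trans ?_ ((Finset.card_union_le _ _).trans (Nat.add_le_add hp hq))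
  exact Finset.card_le_card fun a => by simp

namespace LabelledMultigraph

variable {V E A : Type*} {G : LabelledMultigraph V E A}

theorem eq_of_inDeg_eq_one {v : V} (h : G.inDeg v = 1) {e e' : E} (he : G.tgt e = v)
    (he' : G.tgt e' = v) : e = e' := by
  obtain ⟨a, ha⟩ := Set.ncard_eq_one.1 h
  have h1 : e ∈ ({a} : Set E) := ha ▸ he
  have h2 : e' ∈ ({a} : Set E) := ha ▸ he'
  exact h1.trans h2.symm

theorem eq_of_outDeg_eq_one {v : V} (h : G.outDeg v = 1) {e e' : E} (he : G.src e = v)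
    (he' : G.src e' = v) : e = e' := by
  obtain ⟨a, ha⟩ := Set.ncard_eq_one.1 h
  have h1 : e ∈ ({a} : Set E) := ha ▸ he
  have h2 : e' ∈ ({a} : Set E) := ha ▸ he'
  exact h1.trans h2.symm

theorem exists_tgt_eq_of_inDeg_eq_one {v : V} (h : G.inDeg v = 1) : ∃ e, G.tgt e = v := by
  obtain ⟨a, ha⟩ := Set.ncard_eq_one.1 h
  exact ⟨a, show a ∈ {e | G.tgt e = v} from ha ▸ rfl⟩

theorem exists_src_eq_of_outDeg_eq_one {v : V} (h : G.outDeg v = 1) : ∃ e, G.src e = v := by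
  obtain ⟨a, ha⟩ := Set.ncard_eq_one.1 h
  exact ⟨a, show a ∈ {e | G.src e = v} from ha ▸ rfl⟩

theorem IsDecomposition.deg_eq_one {D : List G.DiPath} (hD : G.IsDecomposition D) {v : V}
    (hv : ¬ G.IsEndpoint D v) : G.inDeg v = 1 ∧ G.outDeg v = 1 := by
  obtain ⟨p, hp, hvp⟩ := hD.2.2.1 v
  refine hD.2.2.2 p hp v ?_
  have hs : v ≠ p.start := fun h => hv ⟨p, hp, Or.inl h⟩
  have hf : v ≠ p.finish := fun h => hv ⟨p, hp, Or.inr h⟩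
  have hmem : v ∈ p.edges.map G.tgt := by
    simpa [DiPath.vertices, hs] using hvp
  rcases List.eq_nil_or_concat' p.edges with h | ⟨l, e, h⟩
  · simp [h] at hmem
  · have hfe : v ≠ G.tgt e := by simpa [DiPath.finish, h] using hf
    simp only [h, List.map_append, List.map_cons, List.map_nil, List.mem_append,
      List.mem_singleton, hfe, or_false] at hmem
    simpa [DiPath.internal, DiPath.vertices, h] using hmem

/-- An edge is the first one of its path, or it starts in an internal vertex of that path. -/
theorem IsDecomposition.head_or_outDeg_eq_one {D : List G.DiPath} (hD : G.IsDecomposition D)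
    (e : E) : (∃ p ∈ D, p.edges.head? = some e) ∨ G.outDeg (G.src e) = 1 := by
  obtain ⟨p, hp, hep⟩ := hD.2.1 e
  obtain ⟨l₁, l₂, hl⟩ := List.append_of_mem hep
  rcases List.eq_nil_or_concat' l₁ with rfl | ⟨l, e₀, rfl⟩
  · exact Or.inl ⟨p, hp, by simp [hl]⟩
  · right
    have hc := p.chain
    rw [hl, List.append_assoc] at hc
    have hc := (List.isChain_append.1 hc).2.1
    have hsrc : G.tgt e₀ = G.src e := by
      simp only [List.singleton_append, List.isChain_cons_cons] at hc
      exact hc.1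
    rw [← hsrc]
    refine (hD.2.2.2 p hp _ ?_).2
    have : ((l ++ [e₀] ++ e :: l₂).map G.tgt).dropLast =
        l.map G.tgt ++ G.tgt e₀ :: (G.tgt e :: l₂.map G.tgt).dropLast := by
      simp [List.dropLast_append_of_ne_nil]
    simp only [DiPath.internal, DiPath.vertices, List.tail_cons, hl, this]
    simp

theorem adjacent_edges {n : ℕ} {π : V ≃ Fin n} {L : List E} (hnd : L.Nodup) (hall : ∀ e, e ∈ L)
    (hsort : L.Pairwise fun e e' => π (G.src e) ≤ π (G.src e')) {e e' : E}
    (ho : G.outDeg (G.src e) = 1) (ho' : G.outDeg (G.src e') = 1)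
    (hπ : (π (G.src e') : ℕ) + 1 = π (G.src e)) : ∃ l₁ l₂, L = l₁ ++ e' :: e :: l₂ := by
  obtain ⟨l₁, l₂, rfl⟩ := List.append_of_mem (hall e')
  have hne : e ≠ e' := by
    rintro rfl
    omega
  rw [List.pairwise_append] at hsort
  obtain ⟨-, hs2, hs3⟩ := hsort
  have he : e ∈ l₂ := by
    have := hall e
    simp only [List.mem_append, List.mem_cons, hne, false_or] at this
    rcases this with h | h
    · have := hs3 e h e' (by simp)
      rw [Fin.le_def] at this
      omega
    · exact h
  cases l₂ with
  | nil => simp at he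
  | cons x l₂ =>
    refine ⟨l₁, l₂, ?_⟩
    suffices x = e by rw [this]
    by_contra hxe
    have he : e ∈ l₂ := by simpa [Ne.symm hxe] using he
    rw [List.pairwise_cons, List.pairwise_cons] at hs2
    have h1 := hs2.1 x (by simp)
    have h2 := hs2.2.1 e he
    have hxe' : x ≠ e' := by
      rintro rfl
      have := (List.nodup_append.1 hnd).2.1
      simp at this
    have h3 : π (G.src x) ≠ π (G.src e') := fun h =>
      hxe' (eq_of_outDeg_eq_one ho' (π.injective h) rfl)
    have h4 : π (G.src x) ≠ π (G.src e) := fun h =>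
      hxe (eq_of_outDeg_eq_one ho (π.injective h) rfl)
    rw [Fin.le_def] at h1 h2
    rw [Ne, Fin.ext_iff] at h3 h4
    omega

/-- Equally labelled edges that leave neighbours in a Wheeler order enter neighbours, if all degrees
involved are 1. -/
theorem IsWheelerOrder.tgt_eq_of_lab_eq [LinearOrder A] {n : ℕ} {π : V ≃ Fin n}
    (hW : G.IsWheelerOrder π) {e e' : E} {v' : V} (hπu : (π (G.src e') : ℕ) + 1 = π (G.src e))
    (hπv : (π v' : ℕ) + 1 = π (G.tgt e)) (hi : G.inDeg (G.tgt e) = 1) (hi' : G.inDeg v' = 1)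
    (ho : G.outDeg (G.src e) = 1) (ho' : G.outDeg (G.src e') = 1) (hlab : G.lab e' = G.lab e) :
    G.tgt e' = v' := by
  have hee : e' ≠ e := by
    rintro rfl
    omega
  have hle := (hW.2 e' e).2 hlab (Fin.lt_def.2 (by omega))
  have hne : π (G.tgt e') ≠ π (G.tgt e) := fun h =>
    hee (eq_of_inDeg_eq_one hi (π.injective h) rfl)
  rw [Fin.le_def] at hle
  rw [Ne, Fin.ext_iff] at hne
  obtain ⟨e₂, rfl⟩ := exists_tgt_eq_of_inDeg_eq_one hi'
  by_contra hcon
  have hne' : (π (G.tgt e') : ℕ) ≠ π (G.tgt e₂) := fun h => hcon (π.injective (Fin.ext h))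
  have hb : G.lab e₂ = G.lab e := by
    rcases lt_trichotomy (G.lab e₂) (G.lab e) with h | h | h
    · have := Fin.lt_def.1 ((hW.2 e₂ e').1 (hlab ▸ h))
      omega
    · exact h
    · have := Fin.lt_def.1 ((hW.2 e e₂).1 h)
      omega
  have hx : ¬ (π (G.src e) < π (G.src e₂)) := fun h => by
    have := Fin.le_def.1 ((hW.2 e e₂).2 hb.symm h)
    omega
  have hx' : ¬ (π (G.src e₂) < π (G.src e')) := fun h => by
    have := Fin.le_def.1 ((hW.2 e₂ e').2 (hb.trans hlab.symm) h)
    omega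
  rw [Fin.lt_def] at hx hx'
  have h1 : (π (G.src e₂) : ℕ) ≠ π (G.src e) := fun h => by
    have := eq_of_outDeg_eq_one ho (π.injective (Fin.ext h)) rfl
    subst this
    omega
  have h2 : (π (G.src e₂) : ℕ) ≠ π (G.src e') := fun h => by
    have := eq_of_outDeg_eq_one ho' (π.injective (Fin.ext h)) rfl
    subst this
    omega
  omega

end LabelledMultigraph

namespace LabelledMultigraph

variable {V E A : Type*} {G : LabelledMultigraph V E A}

/-- `φ` does not grow by one from the vertex with the preceding identifier to `v`. -/
def IsBreak {n : ℕ} (π ident : V ≃ Fin n) (v : V) : Prop :=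
  ∀ u, (ident v : ℕ) = ident u + 1 →
    (wheelerPhi π ident (ident v) : ℕ) ≠ wheelerPhi π ident (ident u) + 1

theorem wheelerPhi_ident {n : ℕ} {π ident : V ≃ Fin n} {v v' : V} (h : (π v' : ℕ) + 1 = π v) :
    wheelerPhi π ident (ident v) = ident v' := by
  unfold wheelerPhi
  congr 1
  rw [Equiv.symm_apply_eq, Fin.ext_iff]
  simp only [Equiv.symm_apply_apply]
  omega

theorem exists_predecessor {n : ℕ} (π : V ≃ Fin n) {v : V} (h : (π v : ℕ) ≠ 0) :
    ∃ v', (π v' : ℕ) + 1 = π v :=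
  ⟨π.symm ⟨(π v : ℕ) - 1, by omega⟩, by simp only [Equiv.apply_symm_apply]; omega⟩

theorem IsBreak.cases [LinearOrder A] {n : ℕ} {π ident : V ≃ Fin n} (hW : G.IsWheelerOrder π)
    {L : List E} (hnd : L.Nodup) (hall : ∀ e, e ∈ L)
    (hsort : L.Pairwise fun e e' => π (G.src e) ≤ π (G.src e')) {D : List G.DiPath}
    (hD : G.IsDecomposition D) (hI : G.IsIdentifierAssignment D ident) {v : V}
    (hv : IsBreak π ident v) :
    (π v : ℕ) = 0 ∨ (∃ u, (π u : ℕ) = 0 ∧ (ident v : ℕ) = ident u + 1) ∨ G.IsEndpoint D v ∨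
      (∃ p ∈ D, ∃ e, p.edges.head? = some e ∧ G.tgt e = v) ∨
      (∃ u, G.IsEndpoint D u ∧ G.outDeg u = 1 ∧ ∃ e, G.src e = u ∧ G.tgt e = v) ∨
      (∃ u', G.IsEndpoint D u' ∧ ∃ u, (π u' : ℕ) + 1 = π u ∧ (ident v : ℕ) = ident u + 1) ∨
      (∃ v', G.IsEndpoint D v' ∧ (π v' : ℕ) + 1 = π v) ∨
      ∃ e ∈ runStarts G.lab L, G.tgt e = v := by
  by_contra! hcon
  obtain ⟨c1, c2, c3, c4, c5, c6, c7, c8⟩ := hcon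
  obtain ⟨hiv, hov⟩ := hD.deg_eq_one c3
  obtain ⟨e, rfl⟩ := exists_tgt_eq_of_inDeg_eq_one hiv
  have hou : G.outDeg (G.src e) = 1 :=
    (hD.head_or_outDeg_eq_one e).resolve_left fun ⟨p, hp, h⟩ => c4 p hp e h rfl
  have hu : ¬ G.IsEndpoint D (G.src e) := fun h => c5 _ h hou e rfl rfl
  have hid := hI e hu c3
  obtain ⟨v', hv'⟩ := exists_predecessor π c1
  obtain ⟨u', hu'⟩ := exists_predecessor π (v := G.src e) fun h => c2 _ h hid
  have hnv' : ¬ G.IsEndpoint D v' := fun h => c7 v' h hv'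
  have hnu' : ¬ G.IsEndpoint D u' := fun h => c6 u' h _ hu' hid
  obtain ⟨hiv', -⟩ := hD.deg_eq_one hnv'
  obtain ⟨-, hou'⟩ := hD.deg_eq_one hnu'
  obtain ⟨e', rfl⟩ := exists_src_eq_of_outDeg_eq_one hou'
  obtain ⟨l₁, l₂, hl⟩ := adjacent_edges hnd hall hsort hou hou' hu'
  have hlab : G.lab e' = G.lab e := by
    by_contra hne
    exact c8 e (hl ▸ mem_runStarts hne l₁ l₂) rfl
  have htgt := hW.tgt_eq_of_lab_eq hu' hv' hiv hiv' hou hou' hlab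
  subst htgt
  apply hv _ hid
  rw [wheelerPhi_ident hv', wheelerPhi_ident hu']
  exact hI e' hnu' hnv'

open Classical in
theorem card_isBreak_le [Fintype V] [LinearOrder A] {n : ℕ} {π ident : V ≃ Fin n}
    (hW : G.IsWheelerOrder π) {B : List A} (hB : G.IsBWT π B) {D : List G.DiPath}
    (hD : G.IsDecomposition D) (hI : G.IsIdentifierAssignment D ident) :
    (Finset.univ.filter fun v => IsBreak π ident v).card ≤ numRuns B + 9 * D.length + 2 := by
  obtain ⟨L, hnd, hall, hsort, rfl⟩ := hB
  let ends : Finset V := (D.map DiPath.start).toFinset ∪ (D.map DiPath.finish).toFinset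
  have hends : ends.card ≤ 2 * D.length := by
    have h1 := Finset.card_union_le (D.map DiPath.start).toFinset (D.map DiPath.finish).toFinset
    have h2 := (D.map DiPath.start).toFinset_card_le
    have h3 := (D.map DiPath.finish).toFinset_card_le
    rw [List.length_map] at h2 h3
    change ((D.map DiPath.start).toFinset ∪ (D.map DiPath.finish).toFinset).card ≤ _
    omega
  have hmem : ∀ {v}, G.IsEndpoint D v → v ∈ ends := by
    rintro v ⟨p, hp, rfl | rfl⟩
    · exact Finset.mem_union_left _ (List.mem_toFinset.2 (List.mem_map_of_mem hp))
    · exact Finset.mem_union_right _ (List.mem_toFinset.2 (List.mem_map_of_mem hp))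
  let heads : Finset E := (D.filterMap fun p => p.edges.head?).toFinset
  have hheads : heads.card ≤ D.length :=
    (List.toFinset_card_le _).trans (List.length_filterMap_le _ _)
  let starts : Finset E := (runStarts G.lab L).toFinset
  have hstarts : starts.card ≤ numRuns (L.map G.lab) :=
    (List.toFinset_card_le _).trans (length_runStarts_le _ _)
  have id_inj : ∀ {v v' : V}, (ident v : ℕ) = ident v' → v = v' := fun h =>
    ident.injective (Fin.ext h)
  have pi_inj : ∀ {v v' : V}, (π v : ℕ) = π v' → v = v' := fun h => π.injective (Fin.ext h)
  have b1 := card_filter_exists_le ({()} : Finset Unit) (fun (v : V) _ => (π v : ℕ) = 0)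
    fun _ a a' h h' => pi_inj (h.trans h'.symm)
  have b2 := card_filter_exists_le ({()} : Finset Unit)
    (fun (v : V) _ => ∃ u, (π u : ℕ) = 0 ∧ (ident v : ℕ) = ident u + 1) (by
      rintro _ a a' ⟨u, h1, h2⟩ ⟨u', h1', h2'⟩
      obtain rfl := pi_inj (h1.trans h1'.symm)
      exact id_inj (h2.trans h2'.symm))
  have b4 := card_filter_exists_le heads (fun (v : V) e => G.tgt e = v)
    fun _ a a' h h' => h.symm.trans h'
  have b5 := card_filter_exists_le ends
    (fun (v : V) u => G.outDeg u = 1 ∧ ∃ e, G.src e = u ∧ G.tgt e = v) (by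
      rintro u a a' ⟨h, e, h1, h2⟩ ⟨-, e', h1', h2'⟩
      rw [← h2, ← h2', eq_of_outDeg_eq_one h h1 h1'])
  have b6 := card_filter_exists_le ends
    (fun (v : V) u' => ∃ u, (π u' : ℕ) + 1 = π u ∧ (ident v : ℕ) = ident u + 1) (by
      rintro _ a a' ⟨u, h1, h2⟩ ⟨u', h1', h2'⟩
      obtain rfl := pi_inj (h1.symm.trans h1')
      exact id_inj (h2.trans h2'.symm))
  have b7 := card_filter_exists_le ends (fun (v : V) v' => (π v' : ℕ) + 1 = π v)
    fun _ a a' h h' => pi_inj (h.symm.trans h')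
  have b8 := card_filter_exists_le starts (fun (v : V) e => G.tgt e = v)
    fun _ a a' h h' => h.symm.trans h'
  have b3 := card_filter_exists_le ends (fun (v : V) w => v = w) fun _ a a' h h' => h.trans h'.symm
  have hcover := card_filter_or_le b1 (card_filter_or_le b2 (card_filter_or_le b3
    (card_filter_or_le b4 (card_filter_or_le b5 (card_filter_or_le b6 (card_filter_or_le b7 b8))))))
  refine (Finset.card_le_card fun v hv => Finset.mem_filter.2 ⟨Finset.mem_univ v, ?_⟩).trans
    (hcover.trans ?_)
  · refine ((Finset.mem_filter.1 hv).2.cases hW hnd hall hsort hD hI).imp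
      (fun h => ⟨(), by simp, h⟩) (Or.imp (fun h => ⟨(), by simp, h⟩)
      (Or.imp (fun h => ⟨v, hmem h, rfl⟩)
      (Or.imp (fun ⟨p, hp, e, he, h⟩ =>
        ⟨e, List.mem_toFinset.2 (List.mem_filterMap.2 ⟨p, hp, he⟩), h⟩)
      (Or.imp (fun ⟨u, hu, h⟩ => ⟨u, hmem hu, h⟩) (Or.imp (fun ⟨u, hu, h⟩ => ⟨u, hmem hu, h⟩)
      (Or.imp (fun ⟨u, hu, h⟩ => ⟨u, hmem hu, h⟩)
      (fun ⟨e, he, h⟩ => ⟨e, List.mem_toFinset.2 he, h⟩)))))))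
  · simp only [Finset.card_singleton]
    omega

end LabelledMultigraph

/-- A finite set of natural numbers, listed in increasing order. -/
theorem exists_strictly_increasing_enumeration (s : Finset ℕ) :
    ∃ key : ℕ → ℕ, (∀ i j, i < j → j < s.card → key i < key j) ∧
      ∀ x, x ∈ s ↔ ∃ i < s.card, key i = x := by
  refine ⟨fun i => if h : i < s.card then s.orderEmbOfFin rfl ⟨i, h⟩ else 0, ?_, ?_⟩
  · intro i j hij hj
    simp only [hj, hij.trans hj, dif_pos]
    exact (s.orderEmbOfFin rfl).strictMono hij
  · intro x
    rw [← Finset.mem_coe, ← Finset.range_orderEmbOfFin s rfl]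
    constructor
    · rintro ⟨i, rfl⟩
      exact ⟨i, i.2, by simp⟩
    · rintro ⟨i, hi, h⟩
      simp only [hi, dif_pos] at h
      exact ⟨_, h⟩

theorem eq_add_sub_of_no_break {f : ℕ → ℕ} {k x : ℕ} (hkx : k ≤ x)
    (h : ∀ i, k < i → i ≤ x → f i = f (i - 1) + 1) : f x = f k + (x - k) := by
  induction x, hkx using Nat.le_induction with
  | base => simp
  | succ x hkx ih =>
    rw [h (x + 1) (by omega) le_rfl, Nat.add_sub_cancel,
      ih fun i h1 h2 => h i h1 (by omega)]
    omega

/-- A function on `{0, …, n - 1}` can be evaluated in `O(log log n)` time if the number of arguments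
at which it does not grow by one is linear in the space. -/
theorem WordRAM.exists_memory_of_breaks {n : ℕ} (f : ℕ → ℕ) (hf : ∀ i < n, f i < n)
    (s : Finset ℕ) (hs : ∀ i ∈ s, i < n) (h0 : 0 ∈ s)
    (hbreak : ∀ i < n, i ∉ s → f i = f (i - 1) + 1) :
    ∃ mem : List ℕ, mem.length ≤ 101 * s.card ∧
      (∀ x ∈ mem, x < 2 ^ (10 * (Nat.log 2 n + 1))) ∧
      ∀ x < n, Answers (10 * (Nat.log 2 n + 1)) searchProgram mem x
        (33 * Nat.log 2 (Nat.log 2 n + 1) + 77) (f x) := by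
  obtain ⟨key, hmono, hkey⟩ := exists_strictly_increasing_enumeration s
  have hm : 0 < s.card := Finset.card_pos.2 ⟨0, h0⟩
  have hnL : n < 2 ^ (Nat.log 2 n + 1) := Nat.lt_pow_succ_log_self (by norm_num) _
  have hcard : s.card ≤ n := by
    simpa using Finset.card_le_card (fun i hi => Finset.mem_range.2 (hs i hi))
  have hlt : ∀ i < s.card, key i < n := fun i hi => hs _ ((hkey _).2 ⟨i, hi, rfl⟩)
  have hmono' : ∀ i j, i ≤ j → j < s.card → key i ≤ key j := by
    intro i j hij hj
    rcases hij.eq_or_lt with rfl | h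
    · exact le_rfl
    · exact (hmono i j h hj).le
  obtain ⟨mem, hlen, hbd, hans⟩ := exists_predecessor_structure (Nat.succ_pos (Nat.log 2 n)) hm
    (hcard.trans hnL.le) key (fun i => f (key i)) (fun i hi => (hlt i hi).trans hnL)
    (fun i hi => (hf _ (hlt i hi)).trans hnL)
  refine ⟨mem, hlen, hbd, fun x hx => ?_⟩
  obtain ⟨i₀, hi₀, hk₀⟩ := (hkey 0).1 h0
  let P : ℕ → Prop := fun i => i < s.card ∧ key i ≤ x
  have hP0 : P i₀ := ⟨hi₀, by omega⟩
  classical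
  have hspec : P (Nat.findGreatest P s.card) := Nat.findGreatest_spec hi₀.le hP0
  have hmax : ∀ i, P i → i ≤ Nat.findGreatest P s.card := fun i hi =>
    Nat.le_findGreatest hi.1.le hi
  generalize Nat.findGreatest P s.card = j at hspec hmax
  have hval : f x = f (key j) + (x - key j) := by
    apply eq_add_sub_of_no_break hspec.2
    intro i hji hix
    apply hbreak i (by omega)
    intro his
    obtain ⟨k, hk, rfl⟩ := (hkey i).1 his
    have := hmono' k j (hmax k ⟨hk, hix⟩) hspec.1
    omega
  rw [hval]
  refine hans x (hx.trans hnL) j hspec.1 fun i hi => ⟨fun h => hmax i ⟨hi, h⟩, fun h => ?_⟩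
  exact (hmono' i j h hspec.1).trans hspec.2

theorem lemma2 :
    ∃ (P : WordRAM.Program) (K C : ℕ), 1 ≤ K ∧
      ∀ (V E A : Type*) [Fintype V] [Fintype E] [LinearOrder A]
        (G : LabelledMultigraph V E A)
        (n : ℕ) (π : V ≃ Fin n) (_ : G.IsWheelerOrder π)
        (B : List A) (_ : G.IsBWT π B)
        (D : List G.DiPath) (_ : G.IsDecomposition D)
        (ident : V ≃ Fin n) (_ : G.IsIdentifierAssignment D ident),
        ∃ mem : List ℕ,
          mem.length ≤ C * (numRuns B + D.length) ∧
          (∀ x ∈ mem, x < 2 ^ (K * (Nat.log 2 n + 1))) ∧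
          ∀ i : Fin n, 0 < (π (ident.symm i) : ℕ) →
            WordRAM.Answers (K * (Nat.log 2 n + 1)) P mem i
              (C * (Nat.log 2 (Nat.log 2 n) + 1)) (wheelerPhi π ident i) := by
  refine ⟨WordRAM.searchProgram, 10, 1212, by norm_num, ?_⟩
  intro V E A _ _ _ G n π hW B hB D hD ident hI
  rcases Nat.eq_zero_or_pos n with rfl | hn
  · exact ⟨[], by simp, by simp, fun i => i.elim0⟩
  classical
  let s : Finset ℕ := (Finset.univ.filter fun v => LabelledMultigraph.IsBreak π ident v).image
    fun v => (ident v : ℕ)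
  have hυ : 1 ≤ D.length := by
    obtain ⟨p, hp, -⟩ := hD.2.2.1 (π.symm ⟨0, hn⟩)
    exact List.length_pos_of_mem hp
  have hcard : s.card ≤ 12 * (numRuns B + D.length) := by
    have := LabelledMultigraph.card_isBreak_le hW hB hD hI
    have h2 : s.card ≤ _ := Finset.card_image_le
    omega
  have hs : ∀ i : Fin n, (i : ℕ) ∉ s → ¬ LabelledMultigraph.IsBreak π ident (ident.symm i) :=
    fun i hi h => hi (Finset.mem_image.2 ⟨ident.symm i, Finset.mem_filter.2
      ⟨Finset.mem_univ _, h⟩, by simp⟩)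
  obtain ⟨mem, hlen, hbd, hans⟩ := WordRAM.exists_memory_of_breaks (n := n)
    (fun i => if h : i < n then (wheelerPhi π ident ⟨i, h⟩ : ℕ) else 0)
    (fun i hi => by simp only [hi, dif_pos]; exact Fin.is_lt _) s
    (by
      intro i hi
      obtain ⟨v, -, rfl⟩ := Finset.mem_image.1 hi
      exact Fin.is_lt _)
    (by
      by_contra h
      exact hs ⟨0, hn⟩ h fun u hu => by simp at hu)
    (by
      intro i hi his
      have h := hs ⟨i, hi⟩ his
      unfold LabelledMultigraph.IsBreak at h
      push Not at h
      obtain ⟨u, hu, heq⟩ := h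
      simp only [Equiv.apply_symm_apply] at hu heq
      have hi' : i - 1 < n := by omega
      have hu' : ident u = ⟨i - 1, hi'⟩ := Fin.ext (by simp only; omega)
      simp only [hi, hi', dif_pos]
      rw [heq, hu'])
  refine ⟨mem, by omega, hbd, fun i _ => ?_⟩
  have h := hans i i.2
  simp only [i.2, dif_pos] at h
  obtain ⟨t, ht, r⟩ := h
  refine ⟨t, ht.trans ?_, r⟩
  have hlog : Nat.log 2 (Nat.log 2 n + 1) ≤ Nat.log 2 (Nat.log 2 n) + 1 := by
    rw [← Nat.lt_succ_iff, Nat.succ_eq_add_one]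
    apply Nat.log_lt_of_lt_pow (by omega)
    have := Nat.lt_pow_succ_log_self (b := 2) (by norm_num) (Nat.log 2 n)
    rw [pow_succ]
    omega
  omega
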